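/- All graphs are finite and simple. A graph is \emph{outerplanar} if it can be drawn in the plane $\mathbb{R}^2$ without crossings (vertices are distinct points, edges are simple arcs joining their ends, no arc contains a vertex other than its ends, and two arcs meet only in common ends) so that every vertex lies on the boundary of the outer (unbounded) face. \textbf{Theorem.} Every $n$-vertex outerplanar graph $G$ contains an independent set $I$ and a collection $\mathcal{C}$ of pairwise vertex-disjoint cycles such that \[ 9|I| \ge 4n - 3|\mathcal{C}|. \] The bound is tight: for every integer $k\ge 0$ the disjoint union of $k$ triangles, which has $n=3k$ vertices, is outerplanar, and every independent set $I$ and every collection $\mathcal{C}$ of pairwise vertex-disjoint cycles in it satisfy $9|I| \le 4n - 3|\mathcal{C}|$. -/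

import Mathlib

namespace SimpleGraph

/-- A drawing of `G` in the plane `ℝ²` without crossings: vertices are distinct points, each edge
`uv` is a simple arc joining the points of `u` and `v`, an arc contains no vertex other than its
two ends, and the arcs of two distinct edges meet only in common ends.
The values of `arc` outside `G.edgeSet` are irrelevant. -/
structure PlaneDrawing {V : Type*} (G : SimpleGraph V) where
  point : V → ℝ × ℝ
  arc : Sym2 V → Set (ℝ × ℝ)
  point_injective : Function.Injective point
  isArc : ∀ u v : V, G.Adj u v →
    ∃ γ : _root_.Path (point u) (point v), Function.Injective γ ∧ Set.range γ = arc s(u, v)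
  mem_of_point_mem_arc : ∀ e ∈ G.edgeSet, ∀ w : V, point w ∈ arc e → w ∈ e
  arc_inter_arc : ∀ e ∈ G.edgeSet, ∀ f ∈ G.edgeSet, e ≠ f →
    ∀ z ∈ arc e ∩ arc f, ∃ w : V, w ∈ e ∧ w ∈ f ∧ z = point w

/-- The set of all points of the plane covered by the drawing. -/
def PlaneDrawing.carrier {V : Type*} {G : SimpleGraph V} (D : G.PlaneDrawing) : Set (ℝ × ℝ) :=
  Set.range D.point ∪ ⋃ e ∈ G.edgeSet, D.arc e

/-- The outer face of the drawing: the points off the drawing whose connected component in the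
complement of the drawing is unbounded. (For a finite graph the carrier is compact, so there is
exactly one unbounded component.) -/
def PlaneDrawing.outerFace {V : Type*} {G : SimpleGraph V} (D : G.PlaneDrawing) : Set (ℝ × ℝ) :=
  {z | z ∈ D.carrierᶜ ∧ ¬ Bornology.IsBounded (connectedComponentIn D.carrierᶜ z)}

/-- `G` is outerplanar: it has a crossing-free drawing in the plane with every vertex on the
boundary of the outer face. -/
def IsOuterplanar {V : Type*} (G : SimpleGraph V) : Prop :=
  ∃ D : G.PlaneDrawing, ∀ v : V, D.point v ∈ frontier D.outerFace

/-- `C` is a collection of pairwise vertex-disjoint cycles of `G`, each given as a subgraph. -/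
def IsDisjointCycleCollection {V : Type*} (G : SimpleGraph V) (C : Finset G.Subgraph) : Prop :=
  (∀ H ∈ C, ∃ (v : V) (p : G.Walk v v), p.IsCycle ∧ p.toSubgraph = H) ∧
    (C : Set G.Subgraph).PairwiseDisjoint Subgraph.verts

/-- The disjoint union of `k` triangles. -/
def disjointTriangles (k : ℕ) : SimpleGraph (Fin k × Fin 3) where
  Adj x y := x.1 = y.1 ∧ x.2 ≠ y.2
  symm := ⟨fun _ _ h => ⟨h.1.symm, h.2.symm⟩⟩
  loopless := ⟨fun _ h => h.2 rfl⟩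

end SimpleGraph

/-!
Place an apex in the outer face of an outerplane drawing of `G` and let an edge from the apex to `v`
follow the outer face until it is close to `v`. This draws the cone over `G` so that edges without
common ends stay disjoint. For two disjoint paths the winding of each around the ends of the other
is constrained modulo `2`; adding these constraints over the pairs of disjoint edges of `K₅` or
`K₃₃` gives a contradiction, so the cone has no such minor and `G` has no `K₄` or `K₂₃` minor.

In a graph without these two minors consider a minimal nonempty set that a clique separates from
the rest. If all degrees are at least two, the clique has exactly two vertices, and walking into the
set from one of them meets a vertex of degree two that lies in a triangle or is adjacent to another
vertex of degree two. The bound follows by induction: delete a vertex of degree at most one with its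
neighbour, or delete the triangle and count it as a cycle, or delete two adjacent vertices of degree
two and join their other neighbours by an edge. Deleting `2`, `3`, `2` vertices costs at most
`8`, `12`, `8` in `4n`, against a gain of `9`, `9 + 3`, `9` in `9|I| + 3|C|`.

For the disjoint triangles an independent set has at most `k` vertices and there are at most `k`
disjoint cycles. Placing the vertices of a graph on a parabola, in an order in which its edges do
not interlace, and joining them by chords gives an outerplane drawing.
-/

namespace Outerplanar

open SimpleGraph

/-! ### Winding of disjoint paths -/

section Winding

open Complex

theorem exists_continuous_log {A : Type*} [TopologicalSpace A] [SimplyConnectedSpace A]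
    [LocallyPathConnectedSpace A] {f : A → ℂ} (hf : Continuous f) (h0 : ∀ a, f a ≠ 0) :
    ∃ L : A → ℂ, Continuous L ∧ ∀ a, exp (L a) = f a := by
  obtain ⟨a₀⟩ : Nonempty A := inferInstance
  obtain ⟨F, ⟨-, hF⟩, -⟩ := isCoveringMapOn_exp.existsUnique_continuousMap_lifts
    (⟨f, hf⟩ : C(A, ℂ)) (a₀ := a₀) (e₀ := log (f a₀)) (by simp [exp_log (h0 a₀)])
    (fun a => by simpa using h0 a)
  exact ⟨F, F.continuous, fun a => congrFun hF a⟩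

theorem sub_eq_sub_of_exp_eq {A : Type*} [TopologicalSpace A] [PreconnectedSpace A] {L M : A → ℂ}
    (hL : Continuous L) (hM : Continuous M) (h : ∀ t, exp (L t) = exp (M t)) (s t : A) :
    L s - M s = L t - M t := by
  choose n hn using fun t => exp_eq_exp_iff_exists_int.1 (h t)
  have hn' : (fun t => (n t : ℝ)) = fun t => ((L t - M t) / (2 * Real.pi * I)).re := by
    funext t
    have : (L t - M t) / (2 * Real.pi * I) = ((n t : ℝ) : ℂ) := by
      rw [hn t, add_sub_cancel_left, mul_div_cancel_right₀ _ two_pi_I_ne_zero, ofReal_intCast]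
    rw [this, ofReal_re]
  have hc : Continuous n := by
    rw [Int.isClosedEmbedding_coe_real.isEmbedding.continuous_iff]
    change Continuous fun t => (n t : ℝ)
    rw [hn']
    fun_prop
  rw [hn s, hn t, PreconnectedSpace.constant inferInstance hc (x := s) (y := t)]
  ring

/-- The total change along the path `γ` of a continuous logarithm of `w ↦ w - z`; it is `0` by
convention when there is no such logarithm, that is, when `γ` passes through `z`. -/
noncomputable def logChange {a b : ℂ} (γ : Path a b) (z : ℂ) : ℂ :=
  open Classical in
  if h : ∃ L : ℝ → ℂ, Continuous L ∧ ∀ t, exp (L t) = γ.extend t - z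
  then h.choose 1 - h.choose 0 else 0

/-- The indicator of `0 < arg z`, which compares the principal logarithms of `z` and `-z`. -/
noncomputable def argPos (z : ℂ) : ℤ := if 0 < arg z then 1 else 0

/-- The number of times that the path `γ` crosses the branch cut of the principal logarithm centred
at `z`, counted with sign. It is meaningful only if `γ` does not pass through `z`. -/
noncomputable def branchCrossings {a b : ℂ} (γ : Path a b) (z : ℂ) : ℤ :=
  round ((logChange γ z - (log (b - z) - log (a - z))) / (2 * Real.pi * I)).re

variable {a b c d z : ℂ}

theorem logChange_eq {γ : Path a b} {L : ℝ → ℂ} (hL : Continuous L)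
    (h : ∀ t, exp (L t) = γ.extend t - z) : logChange γ z = L 1 - L 0 := by
  have hex : ∃ L : ℝ → ℂ, Continuous L ∧ ∀ t, exp (L t) = γ.extend t - z := ⟨L, hL, h⟩
  rw [logChange, dif_pos hex]
  have := sub_eq_sub_of_exp_eq hex.choose_spec.1 hL
    (fun t => (hex.choose_spec.2 t).trans (h t).symm) 0 1
  linear_combination -this

theorem extend_mem_range (γ : Path a b) (t : ℝ) : γ.extend t ∈ Set.range γ :=
  γ.extend_range ▸ Set.mem_range_self t

theorem logChange_add_logChange {γ : Path a b} {δ : Path c d}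
    (h : Disjoint (Set.range γ) (Set.range δ)) :
    logChange γ c + logChange δ b = logChange δ a + logChange γ d := by
  obtain ⟨L, hL, hexp⟩ := exists_continuous_log
    (f := fun q : ℝ × ℝ => γ.extend q.1 - δ.extend q.2) (by fun_prop) fun q hq =>
      Set.disjoint_left.1 h (extend_mem_range γ q.1) (sub_eq_zero.1 hq ▸ extend_mem_range δ q.2)
  have hγ (t : ℝ) : logChange γ (δ.extend t) = L (1, t) - L (0, t) :=
    logChange_eq (L := fun s => L (s, t)) (by fun_prop) fun s => hexp (s, t)
  have hδ (s : ℝ) : logChange δ (γ.extend s) = L (s, 1) - L (s, 0) := by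
    rw [logChange_eq (L := fun t => L (s, t) + Real.pi * I) (by fun_prop)
      fun t => by rw [exp_add, exp_pi_mul_I, hexp]; ring]
    ring
  have hc := hγ 0
  have hd := hγ 1
  have ha := hδ 0
  have hb := hδ 1
  simp only [Path.extend_zero, Path.extend_one] at ha hb hc hd
  rw [ha, hb, hc, hd]
  ring

theorem logChange_eq_add_branchCrossings {γ : Path a b} (hz : z ∉ Set.range γ) :
    logChange γ z = log (b - z) - log (a - z) + branchCrossings γ z * (2 * Real.pi * I) := by
  have h0 (t : ℝ) : γ.extend t - z ≠ 0 := fun ht =>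
    hz (sub_eq_zero.1 ht ▸ extend_mem_range γ t)
  have ha : a - z ≠ 0 := by simpa using h0 0
  have hb : b - z ≠ 0 := by simpa using h0 1
  obtain ⟨L, hL, h⟩ := exists_continuous_log (by fun_prop) h0
  have hexp : exp (logChange γ z) = exp (log (b - z) - log (a - z)) := by
    rw [logChange_eq hL h, exp_sub, exp_sub, h, h, exp_log ha, exp_log hb, Path.extend_zero,
      Path.extend_one]
  obtain ⟨n, hn⟩ := exp_eq_exp_iff_exists_int.1 hexp
  have hround : branchCrossings γ z = n := by
    rw [branchCrossings, hn, add_sub_cancel_left, mul_div_cancel_right₀ _ two_pi_I_ne_zero,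
      intCast_re, round_intCast]
  rw [hround, hn]

theorem log_sub_log_neg (hz : z ≠ 0) : log z - log (-z) = (2 * argPos z - 1) * (Real.pi * I) := by
  unfold argPos
  split_ifs with h
  · have hexp : exp (log z - Real.pi * I) = -z := by
      rw [exp_sub, exp_log hz, exp_pi_mul_I, div_neg, div_one]
    have him : (log z - Real.pi * I).im = arg z - Real.pi := by simp [log_im]
    rw [← hexp, log_exp (by linarith) (by linarith [arg_le_pi z, Real.pi_pos])]
    push_cast
    ring
  · have hexp : exp (log z + Real.pi * I) = -z := by
      rw [exp_add, exp_log hz, exp_pi_mul_I, mul_neg, mul_one]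
    have him : (log z + Real.pi * I).im = arg z + Real.pi := by simp [log_im]
    rw [← hexp, log_exp (by linarith [neg_pi_lt_arg z, Real.pi_pos]) (by linarith)]
    push_cast
    ring

theorem argPos_add_argPos_neg (hz : z ≠ 0) : argPos z + argPos (-z) = 1 := by
  have h := log_sub_log_neg hz
  have h' := log_sub_log_neg (neg_ne_zero.2 hz)
  rw [neg_neg] at h'
  have hpi : (2 * Real.pi * I) ≠ 0 := two_pi_I_ne_zero
  have : ((argPos z + argPos (-z) : ℤ) : ℂ) = (1 : ℤ) := by
    apply mul_right_cancel₀ hpi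
    push_cast
    linear_combination -h - h'
  exact_mod_cast this

theorem branchCrossings_relation {γ : Path a b} {δ : Path c d}
    (h : Disjoint (Set.range γ) (Set.range δ)) :
    branchCrossings γ c - branchCrossings γ d + branchCrossings δ b - branchCrossings δ a +
      (argPos (b - c) + argPos (c - a) + argPos (d - b) + argPos (a - d)) = 2 := by
  have hne {z : ℂ} (hz : z ∈ Set.range γ) {w : ℂ} (hw : w ∈ Set.range δ) : z ≠ w :=
    h.ne_of_mem hz hw
  have ha := γ.source_mem_range
  have hb := γ.target_mem_range
  have hc := δ.source_mem_range
  have hd := δ.target_mem_range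
  have hsum := logChange_add_logChange h
  rw [logChange_eq_add_branchCrossings (Set.disjoint_right.1 h hc),
    logChange_eq_add_branchCrossings (Set.disjoint_right.1 h hd),
    logChange_eq_add_branchCrossings (Set.disjoint_left.1 h ha),
    logChange_eq_add_branchCrossings (Set.disjoint_left.1 h hb)] at hsum
  have hbc := log_sub_log_neg (sub_ne_zero.2 (hne hb hc))
  have hca := log_sub_log_neg (sub_ne_zero.2 (hne ha hc).symm)
  have hdb := log_sub_log_neg (sub_ne_zero.2 (hne hb hd).symm)
  have had := log_sub_log_neg (sub_ne_zero.2 (hne ha hd))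
  rw [neg_sub] at hbc hca hdb had
  rw [← Int.cast_inj (α := ℂ)]
  push_cast
  apply mul_right_cancel₀ two_pi_I_ne_zero
  linear_combination hsum - hbc - hca - hdb - had

end Winding

section Parity

variable {ι κ : Type*}

/-- The number of branch crossings in a drawn triangle: each of its three sides is viewed from the
opposite vertex. -/
noncomputable def triangleCrossings {p : ι → ℂ} (γ : ∀ i j, Path (p i) (p j)) (i j k : ι) : ℤ :=
  branchCrossings (γ i j) (p k) + branchCrossings (γ i k) (p j) + branchCrossings (γ j k) (p i)

theorem odd_triangleCrossings_of_disjoint {p : ι → ℂ} {γ : ∀ i j, Path (p i) (p j)} {i j k l : ι}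
    (hijkl : Disjoint (Set.range (γ i j)) (Set.range (γ k l)))
    (hikjl : Disjoint (Set.range (γ i k)) (Set.range (γ j l)))
    (hiljk : Disjoint (Set.range (γ i l)) (Set.range (γ j k))) :
    Odd (triangleCrossings γ i j k + triangleCrossings γ i j l + triangleCrossings γ i k l +
      triangleCrossings γ j k l) := by
  have hne {z w : ℂ} {s t : Set ℂ} (h : Disjoint s t) (hz : z ∈ s) (hw : w ∈ t) : z - w ≠ 0 :=
    sub_ne_zero.2 (h.ne_of_mem hz hw)
  have hik := argPos_add_argPos_neg (hne hijkl (γ i j).source_mem_range (γ k l).source_mem_range)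
  have hjk := argPos_add_argPos_neg (hne hijkl (γ i j).target_mem_range (γ k l).source_mem_range)
  have hkl := argPos_add_argPos_neg (hne hikjl (γ i k).target_mem_range (γ j l).target_mem_range)
  rw [neg_sub] at hik hjk hkl
  have := branchCrossings_relation hijkl
  have := branchCrossings_relation hikjl
  have := branchCrossings_relation hiljk
  rw [Int.odd_iff]
  unfold triangleCrossings
  omega

theorem not_pairwise_disjoint_paths_K5 {p : Fin 5 → ℂ} (γ : ∀ i j, Path (p i) (p j)) :
    ¬ ∀ i j k l, i ≠ j → k ≠ l → i ≠ k → i ≠ l → j ≠ k → j ≠ l →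
      Disjoint (Set.range (γ i j)) (Set.range (γ k l)) := fun h => by
  have hodd (i j k l : Fin 5) (hij : i < j) (hjk : j < k) (hkl : k < l) :=
    have hik := hij.trans hjk
    have hjl := hjk.trans hkl
    have hil := hij.trans hjl
    Int.odd_iff.1 <| odd_triangleCrossings_of_disjoint
      (h i j k l hij.ne hkl.ne hik.ne hil.ne hjk.ne hjl.ne)
      (h i k j l hik.ne hjl.ne hij.ne hil.ne hjk.ne' hkl.ne)
      (h i l j k hil.ne hjk.ne hij.ne hik.ne hjl.ne' hkl.ne')
  -- Each of the ten triangles lies in two of the five copies of `K₄`, so the odd numbers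
  -- attached to these copies have an even sum.
  have := hodd 0 1 2 3 (by decide) (by decide) (by decide)
  have := hodd 0 1 2 4 (by decide) (by decide) (by decide)
  have := hodd 0 1 3 4 (by decide) (by decide) (by decide)
  have := hodd 0 2 3 4 (by decide) (by decide) (by decide)
  have := hodd 1 2 3 4 (by decide) (by decide) (by decide)
  omega

/-- The number of branch crossings in the drawn path from `x i` through `y j` to `x i'`: each of its
two edges is viewed from the end of the other one, and the positions of the ends relative to `y j`
are taken into account. -/
noncomputable def leftCherryCrossings {x : ι → ℂ} {y : κ → ℂ} (γ : ∀ i j, Path (x i) (y j))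
    (i i' : ι) (j : κ) : ℤ :=
  branchCrossings (γ i j) (x i') + branchCrossings (γ i' j) (x i) +
    argPos (y j - x i) + argPos (y j - x i')

/-- The number of branch crossings in the drawn path from `y j` through `x i` to `y j'`: each of its
two edges is viewed from the end of the other one. -/
noncomputable def rightCherryCrossings {x : ι → ℂ} {y : κ → ℂ} (γ : ∀ i j, Path (x i) (y j))
    (i : ι) (j j' : κ) : ℤ :=
  branchCrossings (γ i j) (y j') + branchCrossings (γ i j') (y j)

theorem odd_cherryCrossings_of_disjoint {x : ι → ℂ} {y : κ → ℂ} {γ : ∀ i j, Path (x i) (y j)}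
    {i i' : ι} {j j' : κ} (h : Disjoint (Set.range (γ i j)) (Set.range (γ i' j')))
    (h' : Disjoint (Set.range (γ i j')) (Set.range (γ i' j))) :
    Odd (leftCherryCrossings γ i i' j + leftCherryCrossings γ i i' j' +
      rightCherryCrossings γ i j j' + rightCherryCrossings γ i' j j') := by
  have hne {z w : ℂ} {s t : Set ℂ} (h : Disjoint s t) (hz : z ∈ s) (hw : w ∈ t) : z - w ≠ 0 :=
    sub_ne_zero.2 (h.ne_of_mem hz hw)
  have hxy := argPos_add_argPos_neg (hne h' (γ i j').source_mem_range (γ i' j).target_mem_range)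
  have hxy' := argPos_add_argPos_neg (hne h (γ i j).source_mem_range (γ i' j').target_mem_range)
  have hyy' := argPos_add_argPos_neg (hne h (γ i j).target_mem_range (γ i' j').target_mem_range)
  rw [neg_sub] at hxy hxy' hyy'
  have := branchCrossings_relation h
  have := branchCrossings_relation h'
  rw [Int.odd_iff]
  unfold leftCherryCrossings rightCherryCrossings
  omega

theorem not_pairwise_disjoint_paths_K33 {x y : Fin 3 → ℂ} (γ : ∀ i j, Path (x i) (y j)) :
    ¬ ∀ i i' j j', i ≠ i' → j ≠ j' →
      Disjoint (Set.range (γ i j)) (Set.range (γ i' j')) := fun h => by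
  have hodd (i i' j j' : Fin 3) (hi : i ≠ i') (hj : j ≠ j') :=
    Int.odd_iff.1 <| odd_cherryCrossings_of_disjoint (h i i' j j' hi hj) (h i i' j' j hi hj.symm)
  -- Each of the eighteen cherries lies in two of the nine 4-cycles, so the odd numbers attached
  -- to these cycles have an even sum.
  have := hodd 0 1 0 1 (by decide) (by decide)
  have := hodd 0 1 0 2 (by decide) (by decide)
  have := hodd 0 1 1 2 (by decide) (by decide)
  have := hodd 0 2 0 1 (by decide) (by decide)
  have := hodd 0 2 0 2 (by decide) (by decide)
  have := hodd 0 2 1 2 (by decide) (by decide)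
  have := hodd 1 2 0 1 (by decide) (by decide)
  have := hodd 1 2 0 2 (by decide) (by decide)
  have := hodd 1 2 1 2 (by decide) (by decide)
  omega

end Parity

/-! ### Minors and weak drawings -/

section Minors

variable {V W X : Type*} {G : SimpleGraph V} {H : SimpleGraph W} {K : SimpleGraph X}

/-- Two sets of vertices touch if some edge joins them. -/
def Touch (G : SimpleGraph V) (S T : Set V) : Prop :=
  ∃ a ∈ S, ∃ b ∈ T, G.Adj a b

/-- `H` is a minor of `G`. The set `B i` is the branch set of the vertex `i` of `H`, which is
contracted to `i`. -/
def IsMinor (H : SimpleGraph W) (G : SimpleGraph V) : Prop :=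
  ∃ B : W → Set V, (∀ i, (G.induce (B i)).Connected) ∧ (∀ i j, i ≠ j → Disjoint (B i) (B j)) ∧
    ∀ i j, H.Adj i j → Touch G (B i) (B j)

theorem Touch.symm {S T : Set V} : Touch G S T → Touch G T S :=
  fun ⟨a, ha, b, hb, hab⟩ => ⟨b, hb, a, ha, hab.symm⟩

theorem Touch.mono {S S' T T' : Set V} (h : Touch G S T) (hS : S ⊆ S') (hT : T ⊆ T') :
    Touch G S' T' :=
  let ⟨a, ha, b, hb, hab⟩ := h
  ⟨a, hS ha, b, hT hb, hab⟩

theorem connected_induce_singleton (v : V) : (G.induce {v}).Connected :=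
  .of_subsingleton

theorem connected_induce_union_of_touch {S T : Set V} (hS : (G.induce S).Connected)
    (hT : (G.induce T).Connected) (h : Touch G S T) : (G.induce (S ∪ T)).Connected :=
  let ⟨_, ha, _, hb, hab⟩ := h
  connected_induce_union hS.preconnected hT.preconnected ha hb hab

theorem connected_induce_biUnion {S : Set W} {B : W → Set V} (hS : (H.induce S).Connected)
    (hB : ∀ i ∈ S, (G.induce (B i)).Connected)
    (hadj : ∀ i ∈ S, ∀ j ∈ S, H.Adj i j → Touch G (B i) (B j)) :
    (G.induce (⋃ i ∈ S, B i)).Connected := by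
  obtain ⟨i, hi⟩ := hS.nonempty
  have hchain (j : S) : ∃ T ⊆ ⋃ k ∈ S, B k, B i ⊆ T ∧ B j ⊆ T ∧ (G.induce T).Connected := by
    have hij := (reachable_iff_reflTransGen _ _).1 (hS.preconnected ⟨i, hi⟩ j)
    induction hij with
    | refl => exact ⟨B i, Set.subset_biUnion_of_mem hi, subset_rfl, subset_rfl, hB i hi⟩
    | @tail j k _ hjk ih =>
      obtain ⟨T, hTsub, hiT, hjT, hT⟩ := ih
      exact ⟨T ∪ B k, Set.union_subset hTsub (Set.subset_biUnion_of_mem k.2),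
        hiT.trans Set.subset_union_left, Set.subset_union_right,
        connected_induce_union_of_touch hT (hB k k.2) <|
          (hadj j j.2 k k.2 hjk).mono hjT subset_rfl⟩
  obtain ⟨⟨v, hv⟩⟩ := (hB i hi).nonempty
  refine induce_connected_of_patches v (Set.mem_biUnion hi hv) fun hw => ?_
  obtain ⟨j, hj, hwj⟩ := Set.mem_iUnion₂.1 hw
  obtain ⟨T, hTsub, hiT, hjT, hT⟩ := hchain ⟨j, hj⟩
  exact ⟨T, hTsub, hiT hv, hjT hwj, hT.preconnected _ _⟩

theorem IsMinor.of_isContained (h : H ⊑ G) : IsMinor H G := by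
  obtain ⟨f⟩ := h
  exact ⟨fun i => {f i}, fun i => connected_induce_singleton (f i),
    fun i j hij => Set.disjoint_singleton.2 (f.injective.ne hij),
    fun i j hij => ⟨f i, rfl, f j, rfl, f.toHom.map_adj hij⟩⟩

theorem IsMinor.trans (hHG : IsMinor H G) (hGK : IsMinor G K) : IsMinor H K := by
  obtain ⟨B, hB, hBd, hBadj⟩ := hHG
  obtain ⟨C, hC, hCd, hCadj⟩ := hGK
  refine ⟨fun i => ⋃ v ∈ B i, C v, fun i => connected_induce_biUnion (hB i) (fun v _ => hC v)
    fun u _ v _ => hCadj u v, fun i j hij => ?_, fun i j hij => ?_⟩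
  · simp only [Set.disjoint_iUnion_left, Set.disjoint_iUnion_right]
    exact fun u hu v hv => hCd _ _ ((hBd i j hij).ne_of_mem hv hu)
  · obtain ⟨u, hu, v, hv, huv⟩ := hBadj i j hij
    exact (hCadj u v huv).mono (Set.subset_biUnion_of_mem hu) (Set.subset_biUnion_of_mem hv)

/-- The cone over `G`: a new vertex `none` adjacent to all vertices of `G`. -/
def cone (G : SimpleGraph V) : SimpleGraph (Option V) where
  Adj
    | some u, some v => G.Adj u v
    | some _, none | none, some _ => True
    | none, none => False
  symm := ⟨by rintro (_ | u) (_ | v) <;> simp [G.adj_comm]⟩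
  loopless := ⟨by rintro (_ | u) <;> simp⟩

theorem IsMinor.cone (h : IsMinor H G) : IsMinor (cone H) (cone G) := by
  obtain ⟨B, hB, hBd, hBadj⟩ := h
  let B' : Option W → Set (Option V) := fun i => i.elim {none} fun i => some '' B i
  have hBne (i : W) : (B i).Nonempty := Set.nonempty_coe_sort.1 (hB i).nonempty
  refine ⟨B', ?_, ?_, ?_⟩
  · rintro (_ | i)
    · exact connected_induce_singleton none
    · let f : G.induce (B i) →g (Outerplanar.cone G).induce (some '' B i) :=
        ⟨fun v => ⟨some v, v, v.2, rfl⟩, fun h => h⟩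
      refine (hB i).map f ?_
      rintro ⟨_, v, hv, rfl⟩
      exact ⟨⟨v, hv⟩, rfl⟩
  · rintro (_ | i) (_ | j) hij
    · exact absurd rfl hij
    · simp [B']
    · simp [B']
    · exact (Set.disjoint_image_iff (Option.some_injective V)).2
        (hBd i j fun h => hij (congrArg some h))
  · rintro (_ | i) (_ | j) hij
    · exact hij.elim
    · obtain ⟨v, hv⟩ := hBne j
      exact ⟨none, rfl, some v, ⟨v, hv, rfl⟩, trivial⟩
    · obtain ⟨v, hv⟩ := hBne i
      exact ⟨some v, ⟨v, hv, rfl⟩, none, rfl, trivial⟩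
    · obtain ⟨u, hu, v, hv, huv⟩ := hBadj i j hij
      exact ⟨some u, ⟨u, hu, rfl⟩, some v, ⟨v, hv, rfl⟩, huv⟩

theorem completeGraph_isContained_cone :
    completeGraph (Fin 5) ⊑ cone (completeGraph (Fin 4)) := by
  refine ⟨⟨⟨finSuccEquiv 4, fun {i j} hij => ?_⟩, (finSuccEquiv 4).injective⟩⟩
  have hne := (finSuccEquiv 4).injective.ne hij
  rcases hi : finSuccEquiv 4 i with _ | i <;> rcases hj : finSuccEquiv 4 j with _ | j
  · exact absurd (hi.trans hj.symm) hne
  · trivial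
  · trivial
  · exact fun h => hne (by rw [hi, hj, h])

theorem completeBipartiteGraph_isContained_cone :
    completeBipartiteGraph (Fin 3) (Fin 3) ⊑
      cone (completeBipartiteGraph (Fin 2) (Fin 3)) := by
  let f : Fin 3 ⊕ Fin 3 → Option (Fin 2 ⊕ Fin 3) :=
    Sum.elim (fun i => (finSuccEquiv 2 i).map Sum.inl) (fun j => some (Sum.inr j))
  have hf : Function.Injective f := by decide
  refine ⟨⟨⟨f, fun {i j} hij => ?_⟩, hf⟩⟩
  rcases i with i | i <;> rcases j with j | j
  · simp at hij
  · cases h : finSuccEquiv 2 i <;> simp [f, h, cone]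
  · cases h : finSuccEquiv 2 j <;> simp [f, h, cone]
  · simp at hij

end Minors

section WeakDrawings

variable {V W X Y : Type*} [TopologicalSpace X] [TopologicalSpace Y]
  {G : SimpleGraph V} {H : SimpleGraph W}

/-- A weak form of planarity, for drawings in `X`: vertices go to points, and every edge `uv` has a
region `A u v` in which its ends can be joined, such that the regions of edges without common ends
are disjoint. Points may coincide or lie in the regions of other edges, which makes this condition
easy to establish. The region may depend on the orientation of the edge. -/
def IsWeaklyDrawable (X : Type*) [TopologicalSpace X] (G : SimpleGraph V) : Prop :=
  ∃ (p : V → X) (A : V → V → Set X), (∀ u v, G.Adj u v → JoinedIn (A u v) (p u) (p v)) ∧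
    ∀ u v x y, G.Adj u v → G.Adj x y → u ≠ x → u ≠ y → v ≠ x → v ≠ y → Disjoint (A u v) (A x y)

theorem IsWeaklyDrawable.map {f : X → Y} (hG : IsWeaklyDrawable X G) (hf : Continuous f)
    (hinj : Function.Injective f) : IsWeaklyDrawable Y G :=
  let ⟨p, A, hA, hd⟩ := hG
  ⟨f ∘ p, fun u v => f '' A u v, fun u v huv => JoinedIn.map (hA u v huv) hf,
    fun u v x y huv hxy h₁ h₂ h₃ h₄ =>
      (Set.disjoint_image_iff hinj).2 (hd u v x y huv hxy h₁ h₂ h₃ h₄)⟩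

/-- The part of a weak drawing with edge regions `A` that belongs to the edges inside `S`. -/
def edgeRegion (G : SimpleGraph V) (A : V → V → Set X) (S : Set V) : Set X :=
  {z | ∃ u ∈ S, ∃ v ∈ S, G.Adj u v ∧ z ∈ A u v}

theorem joinedIn_edgeRegion_of_reachable {p : V → X} {A : V → V → Set X}
    (hA : ∀ u v, G.Adj u v → JoinedIn (A u v) (p u) (p v)) {S : Set V} {u v : S} (huv : u ≠ v)
    (h : (G.induce S).Reachable u v) : JoinedIn (edgeRegion G A S) (p u) (p v) := by
  have hedge (x y : S) (hxy : G.Adj x y) : JoinedIn (edgeRegion G A S) (p x) (p y) :=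
    (hA x y hxy).mono fun z hz => ⟨x, x.2, y, y.2, hxy, hz⟩
  rw [reachable_iff_reflTransGen] at h
  suffices u = v ∨ JoinedIn (edgeRegion G A S) (p u) (p v) from this.resolve_left huv
  clear huv
  induction h with
  | refl => exact .inl rfl
  | @tail x y _ hxy ih =>
    right
    rcases ih with rfl | ih
    exacts [hedge _ _ hxy, ih.trans (hedge _ _ hxy)]

theorem IsWeaklyDrawable.of_isMinor (hG : IsWeaklyDrawable X G) (h : IsMinor H G) :
    IsWeaklyDrawable X H := by
  obtain ⟨p, A, hA, hAd⟩ := hG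
  obtain ⟨B, hB, hBd, hBadj⟩ := h
  choose r hr using fun i => Set.nonempty_coe_sort.1 (hB i).nonempty
  refine ⟨p ∘ r, fun i j => edgeRegion G A (B i ∪ B j), fun i j hij => ?_,
    fun i j k l _ _ hik hil hjk hjl => ?_⟩
  · have hconn := connected_induce_union_of_touch (hB i) (hB j) (hBadj i j hij)
    have hne : r i ≠ r j := (hBd i j hij.ne).ne_of_mem (hr i) (hr j)
    exact joinedIn_edgeRegion_of_reachable hA (u := ⟨r i, .inl (hr i)⟩) (v := ⟨r j, .inr (hr j)⟩)
      (fun h => hne (congrArg Subtype.val h)) (hconn.preconnected _ _)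
  · have hd : Disjoint (B i ∪ B j) (B k ∪ B l) := by
      simp only [Set.disjoint_union_left, Set.disjoint_union_right]
      exact ⟨⟨hBd i k hik, hBd j k hjk⟩, hBd i l hil, hBd j l hjl⟩
    refine Set.disjoint_left.2 ?_
    rintro z ⟨u, hu, v, hv, huv, hz⟩ ⟨x, hx, y, hy, hxy, hz'⟩
    exact Set.disjoint_left.1 (hAd u v x y huv hxy (hd.ne_of_mem hu hx) (hd.ne_of_mem hu hy)
      (hd.ne_of_mem hv hx) (hd.ne_of_mem hv hy)) hz hz'

theorem IsWeaklyDrawable.exists_path [PathConnectedSpace X] (hG : IsWeaklyDrawable X G) :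
    ∃ (p : V → X) (γ : ∀ u v, Path (p u) (p v)), ∀ u v x y, G.Adj u v → G.Adj x y →
      u ≠ x → u ≠ y → v ≠ x → v ≠ y → Disjoint (Set.range (γ u v)) (Set.range (γ x y)) := by
  obtain ⟨p, A, hA, hd⟩ := hG
  have hpath (u v : V) : ∃ γ : Path (p u) (p v), G.Adj u v → Set.range γ ⊆ A u v := by
    by_cases huv : G.Adj u v
    · exact ⟨(hA u v huv).somePath, fun _ => Set.range_subset_iff.2 (hA u v huv).somePath_mem⟩
    · exact ⟨PathConnectedSpace.somePath _ _, fun h => absurd h huv⟩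
  choose γ hγ using hpath
  exact ⟨p, γ, fun u v x y huv hxy h₁ h₂ h₃ h₄ =>
    (hd u v x y huv hxy h₁ h₂ h₃ h₄).mono (hγ u v huv) (hγ x y hxy)⟩

theorem not_isWeaklyDrawable_K5 : ¬ IsWeaklyDrawable ℂ (completeGraph (Fin 5)) := fun h =>
  let ⟨_, γ, hγ⟩ := h.exists_path
  not_pairwise_disjoint_paths_K5 γ hγ

theorem not_isWeaklyDrawable_K33 :
    ¬ IsWeaklyDrawable ℂ (completeBipartiteGraph (Fin 3) (Fin 3)) := fun h =>
  let ⟨_, γ, hγ⟩ := h.exists_path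
  not_pairwise_disjoint_paths_K33 (fun i j => γ (.inl i) (.inr j)) fun i i' j j' hi hj =>
    hγ _ _ _ _ (by simp) (by simp) (by simpa using hi) (by simp) (by simp) (by simpa using hj)

/-- `G` has neither of the two excluded minors `K₄` and `K₂₃` of outerplanar graphs. -/
def IsOuterplanarMinorFree (G : SimpleGraph V) : Prop :=
  ¬ IsMinor (completeGraph (Fin 4)) G ∧ ¬ IsMinor (completeBipartiteGraph (Fin 2) (Fin 3)) G

theorem IsOuterplanarMinorFree.of_isMinor (hG : IsOuterplanarMinorFree G) (h : IsMinor H G) :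
    IsOuterplanarMinorFree H :=
  ⟨fun h' => hG.1 (h'.trans h), fun h' => hG.2 (h'.trans h)⟩

theorem IsWeaklyDrawable.isOuterplanarMinorFree (h : IsWeaklyDrawable ℂ (cone G)) :
    IsOuterplanarMinorFree G :=
  ⟨fun hK => not_isWeaklyDrawable_K5 <| h.of_isMinor <|
      (IsMinor.of_isContained completeGraph_isContained_cone).trans hK.cone,
    fun hK => not_isWeaklyDrawable_K33 <| h.of_isMinor <|
      (IsMinor.of_isContained completeBipartiteGraph_isContained_cone).trans hK.cone⟩

end WeakDrawings

/-! ### Plane drawings -/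

section PlaneDrawings

variable {V : Type*} {G : SimpleGraph V}

theorem isPreconnected_setOf_lt_norm {E : Type*} [NormedAddCommGroup E] [NormedSpace ℝ E]
    (hE : 1 < Module.rank ℝ E) {M : ℝ} (hM : 0 ≤ M) : IsPreconnected {z : E | M < ‖z‖} := by
  have hpolar : {z : E | M < ‖z‖} =
      (fun q : E × ℝ => q.2 • q.1) '' (Metric.sphere (0 : E) 1 ×ˢ Set.Ioi M) := by
    ext z
    constructor
    · intro (hz : M < ‖z‖)
      have hpos : ‖z‖ ≠ 0 := (hM.trans_lt hz).ne'
      exact ⟨(‖z‖⁻¹ • z, ‖z‖), ⟨by simp [norm_smul, hpos], hz⟩, by simp [smul_smul, hpos]⟩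
    · rintro ⟨⟨x, r⟩, ⟨hx, hr : M < r⟩, rfl⟩
      have hx' : ‖x‖ = 1 := by simpa using hx
      simpa [norm_smul, hx', abs_of_pos (hM.trans_lt hr)] using hr
  rw [hpolar]
  exact ((isPreconnected_sphere hE 0 1).prod isPreconnected_Ioi).image _ (by fun_prop)

theorem isCompact_arc (D : G.PlaneDrawing) {e : Sym2 V} (he : e ∈ G.edgeSet) :
    IsCompact (D.arc e) := by
  induction e using Sym2.ind with
  | _ u v =>
    obtain ⟨γ, -, hγ⟩ := D.isArc u v he
    exact hγ ▸ isCompact_range γ.continuous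

theorem arc_subset_carrier (D : G.PlaneDrawing) {e : Sym2 V} (he : e ∈ G.edgeSet) :
    D.arc e ⊆ D.carrier :=
  fun _ hz => .inr (Set.mem_biUnion he hz)

theorem isCompact_carrier [Finite V] (D : G.PlaneDrawing) : IsCompact D.carrier :=
  (Set.finite_range _).isCompact.union
    ((Set.toFinite G.edgeSet).isCompact_biUnion fun _ he => isCompact_arc D he)

theorem exists_isPathConnected_superset_outerFace [Finite V] (D : G.PlaneDrawing) :
    ∃ U : Set (ℝ × ℝ), IsPathConnected U ∧ U ⊆ D.carrierᶜ ∧ D.outerFace ⊆ U := by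
  obtain ⟨M, hM0, hM⟩ := (isCompact_carrier D).isBounded.subset_closedBall_lt 0 0
  have hfar : {z : ℝ × ℝ | M < ‖z‖} ⊆ D.carrierᶜ := fun z (hz : M < ‖z‖) hz' =>
    hz.not_ge (mem_closedBall_zero_iff.1 (hM hz'))
  have hrank : 1 < Module.rank ℝ (ℝ × ℝ) := by
    rw [rank_prod', Module.rank_self, one_add_one_eq_two]
    exact_mod_cast one_lt_two
  obtain ⟨w, hw⟩ := NormedSpace.exists_lt_norm ℝ (ℝ × ℝ) M
  refine ⟨connectedComponentIn D.carrierᶜ w, ?_, connectedComponentIn_subset _ _, ?_⟩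
  · rw [← ((isCompact_carrier D).isClosed.isOpen_compl
      |>.connectedComponentIn).isConnected_iff_isPathConnected]
    exact isConnected_connectedComponentIn_iff.2 (hfar hw)
  · rintro z ⟨hz, hunbounded⟩
    obtain ⟨z', hz', hnorm⟩ : ∃ z' ∈ connectedComponentIn D.carrierᶜ z, M < ‖z'‖ := by
      by_contra! hcon
      exact hunbounded (Metric.isBounded_closedBall.subset fun z' hz' =>
        mem_closedBall_zero_iff.2 (hcon z' hz'))
    have hz'w : z' ∈ connectedComponentIn D.carrierᶜ w :=
      (isPreconnected_setOf_lt_norm hrank hM0.le).subset_connectedComponentIn hw hfar hnorm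
    rw [connectedComponentIn_eq hz'w, ← connectedComponentIn_eq hz']
    exact mem_connectedComponentIn hz

theorem disjoint_arc (D : G.PlaneDrawing) {u v x y : V} (huv : G.Adj u v) (hxy : G.Adj x y)
    (hux : u ≠ x) (huy : u ≠ y) (hvx : v ≠ x) (hvy : v ≠ y) :
    Disjoint (D.arc s(u, v)) (D.arc s(x, y)) := by
  refine Set.disjoint_left.2 fun z hz hz' => ?_
  have hne : s(u, v) ≠ s(x, y) := by simp [hux, huy]
  obtain ⟨w, hw, hw', -⟩ := D.arc_inter_arc _ huv _ hxy hne z ⟨hz, hz'⟩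
  rcases Sym2.mem_iff.1 hw with rfl | rfl
  exacts [(Sym2.mem_iff.1 hw').elim hux huy, (Sym2.mem_iff.1 hw').elim hvx hvy]

theorem exists_ball_disjoint_arcs [Finite V] (D : G.PlaneDrawing) (v : V) :
    ∃ ε > 0, ∀ x y, G.Adj x y → v ≠ x → v ≠ y →
      Disjoint (Metric.ball (D.point v) ε) (D.arc s(x, y)) := by
  have hclosed : IsClosed (⋃ e ∈ {e ∈ G.edgeSet | v ∉ e}, D.arc e) :=
    (Set.toFinite _).isClosed_biUnion fun e he => (isCompact_arc D he.1).isClosed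
  have hv : D.point v ∉ ⋃ e ∈ {e ∈ G.edgeSet | v ∉ e}, D.arc e := fun h =>
    let ⟨e, he, hz⟩ := Set.mem_iUnion₂.1 h
    he.2 (D.mem_of_point_mem_arc e he.1 v hz)
  obtain ⟨ε, hε, hsub⟩ := Metric.isOpen_iff.1 hclosed.isOpen_compl _ hv
  refine ⟨ε, hε, fun x y hxy hx hy => Set.disjoint_left.2 fun z hz hz' => hsub hz ?_⟩
  exact Set.mem_biUnion (x := s(x, y)) ⟨hxy, by simp [hx, hy]⟩ hz'

theorem isWeaklyDrawable_cone_of_isOuterplanar [Finite V] (hG : G.IsOuterplanar) :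
    IsWeaklyDrawable (ℝ × ℝ) (cone G) := by
  obtain ⟨D, hD⟩ := hG
  obtain ⟨U, hU, hUc, hUo⟩ := exists_isPathConnected_superset_outerFace D
  obtain ⟨w, hw⟩ := hU.nonempty
  choose ε hε hball using exists_ball_disjoint_arcs D
  let ray (v : V) : Set (ℝ × ℝ) := U ∪ Metric.ball (D.point v) (ε v)
  have hray (v : V) : JoinedIn (ray v) w (D.point v) := by
    obtain ⟨z, hz, hzU⟩ := Metric.mem_closure_iff.1 (frontier_subset_closure (hD v)) (ε v) (hε v)
    rw [← Metric.mem_ball'] at hzU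
    exact ((hU.joinedIn w hw z (hUo hz)).mono Set.subset_union_left).trans
      (((Metric.isPathConnected_ball (hε v)).joinedIn z hzU _
        (Metric.mem_ball_self (hε v))).mono Set.subset_union_right)
  have hray_arc (v x y : V) (hxy : G.Adj x y) (hx : v ≠ x) (hy : v ≠ y) :
      Disjoint (ray v) (D.arc s(x, y)) :=
    Set.disjoint_union_left.2 ⟨(Set.disjoint_compl_left_iff_subset.2
      (arc_subset_carrier D hxy)).mono_left hUc, hball v x y hxy hx hy⟩
  let A : Option V → Option V → Set (ℝ × ℝ)
    | some u, some v => D.arc s(u, v)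
    | some v, none | none, some v => ray v
    | none, none => ∅
  refine ⟨fun v => v.elim w D.point, A, ?_, ?_⟩
  · rintro (_ | u) (_ | v) huv
    · exact huv.elim
    · exact hray v
    · exact (hray u).symm
    · obtain ⟨γ, -, hγ⟩ := D.isArc u v huv
      exact ⟨γ, fun t => hγ.subset (Set.mem_range_self t)⟩
  · rintro (_ | u) (_ | v) (_ | x) (_ | y) huv hxy hux huy hvx hvy
    all_goals first
      | exact huv.elim
      | exact hxy.elim
      | contradiction
      | simp only [ne_eq, Option.some.injEq] at hux huy hvx hvy
    all_goals first
      | exact hray_arc _ _ _ hxy ‹_› ‹_›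
      | exact (hray_arc _ _ _ huv (Ne.symm ‹_›) (Ne.symm ‹_›)).symm
      | exact disjoint_arc D huv hxy hux huy hvx hvy

theorem isOuterplanarMinorFree_of_isOuterplanar [Finite V] (hG : G.IsOuterplanar) :
    IsOuterplanarMinorFree G :=
  ((isWeaklyDrawable_cone_of_isOuterplanar hG).map
    Complex.equivRealProdCLM.symm.continuous
      Complex.equivRealProdCLM.symm.injective).isOuterplanarMinorFree

end PlaneDrawings

/-! ### Ends of graphs without the excluded minors -/

section Boundary

variable {V : Type*} {G : SimpleGraph V} {A S T : Set V}

/-- The vertices outside `S` that have a neighbour in `S`. -/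
def boundary (G : SimpleGraph V) (S : Set V) : Set V :=
  {v | v ∉ S ∧ ∃ u ∈ S, G.Adj u v}

theorem boundary_subset_of_disjoint (hST : S ⊆ T) (h : Disjoint (boundary G S) T) :
    boundary G S ⊆ boundary G T := fun _ hv =>
  let ⟨u, hu, huv⟩ := hv.2
  ⟨Set.disjoint_left.1 h hv, u, hST hu, huv⟩

theorem touch_of_mem_boundary {v : V} (hv : v ∈ boundary G S) : Touch G S {v} :=
  let ⟨_, u, hu, huv⟩ := hv
  ⟨u, hu, v, rfl, huv⟩

theorem eq_of_preconnected_of_disjoint_boundary (hA : (G.induce A).Preconnected)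
    (hS : S.Nonempty) (hSA : S ⊆ A) (h : Disjoint (boundary G S) A) : S = A := by
  obtain ⟨s, hs⟩ := hS
  refine hSA.antisymm fun v hv => ?_
  have hsv := (reachable_iff_reflTransGen _ _).1 (hA ⟨s, hSA hs⟩ ⟨v, hv⟩)
  suffices ∀ w : A, Relation.ReflTransGen (G.induce A).Adj ⟨s, hSA hs⟩ w → (w : V) ∈ S from
    this _ hsv
  intro w hw
  induction hw with
  | refl => exact hs
  | @tail x y _ hxy ih =>
    by_contra hy
    exact Set.disjoint_left.1 h ⟨hy, x, ih, hxy⟩ y.2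

theorem exists_connected_disjoint_boundary {s : V} (hs : s ∈ A) :
    ∃ K ⊆ A, s ∈ K ∧ (G.induce K).Connected ∧ Disjoint (boundary G K) A := by
  let C := (G.induce A).connectedComponentMk ⟨s, hs⟩
  have hmem {v : V} (hv : v ∈ A) : v ∈ Subtype.val '' C.supp ↔
      (G.induce A).connectedComponentMk ⟨v, hv⟩ = C := by
    simp [hv, ConnectedComponent.mem_supp_iff]
  refine ⟨Subtype.val '' C.supp, by simp, (hmem hs).2 rfl, ?_, ?_⟩
  · let f : (G.induce A).induce C.supp →g G.induce (Subtype.val '' C.supp) :=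
      ⟨fun v => ⟨v, v, v.2, rfl⟩, fun h => h⟩
    refine C.maximal_connected_induce_supp.prop.map f ?_
    rintro ⟨_, v, hv, rfl⟩
    exact ⟨⟨v, hv⟩, rfl⟩
  · refine Set.disjoint_left.2 ?_
    rintro v ⟨hvC, _, ⟨u, hu, rfl⟩, huv⟩ hv
    refine hvC ((hmem hv).2 ?_)
    rw [← (ConnectedComponent.mem_supp_iff _ _).1 hu]
    exact (ConnectedComponent.connectedComponentMk_eq_of_adj (by exact huv)).symm

theorem exists_disjoint_connected_of_not_preconnected (hA : ¬ (G.induce A).Preconnected) :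
    ∃ K ⊆ A, ∃ L ⊆ A, Disjoint K L ∧ (G.induce K).Connected ∧ (G.induce L).Connected ∧
      Disjoint (boundary G K) A ∧ Disjoint (boundary G L) A := by
  obtain ⟨⟨s, hs⟩⟩ : Nonempty A := by
    by_contra! hempty
    exact hA fun v => (hempty.false v).elim
  obtain ⟨K, hKA, -, hK, hKb⟩ := exists_connected_disjoint_boundary (G := G) hs
  obtain ⟨t, htA, htK⟩ : ∃ t ∈ A, t ∉ K := by
    by_contra! hAK
    exact hA (hKA.antisymm hAK ▸ hK.preconnected)
  obtain ⟨L, hLA, -, hL, hLb⟩ :=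
    exists_connected_disjoint_boundary (G := G) (A := A \ K) ⟨htA, htK⟩
  refine ⟨K, hKA, L, hLA.trans Set.sdiff_subset, Set.disjoint_left.2 fun v hvK hvL =>
    (hLA hvL).2 hvK, hK, hL, hKb, Set.disjoint_left.2 fun v hv hvA => ?_⟩
  have hvK : v ∈ K := by
    by_contra hvK
    exact Set.disjoint_left.1 hLb hv ⟨hvA, hvK⟩
  obtain ⟨-, u, hu, huv⟩ := hv
  exact Set.disjoint_left.1 hKb ⟨(hLA hu).2, v, hvK, huv.symm⟩ (hLA hu).1

end Boundary

section ExcludedMinors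

variable {V : Type*} {G : SimpleGraph V}

theorem isMinor_K4_of_touch {A B C D : Set V} (hA : (G.induce A).Connected)
    (hB : (G.induce B).Connected) (hC : (G.induce C).Connected) (hD : (G.induce D).Connected)
    (hAB : Disjoint A B) (hAC : Disjoint A C) (hAD : Disjoint A D) (hBC : Disjoint B C)
    (hBD : Disjoint B D) (hCD : Disjoint C D)
    (tAB : Touch G A B) (tAC : Touch G A C) (tAD : Touch G A D) (tBC : Touch G B C)
    (tBD : Touch G B D) (tCD : Touch G C D) : IsMinor (completeGraph (Fin 4)) G := by
  refine ⟨![A, B, C, D], ?_, ?_, ?_⟩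
  · simp [Fin.forall_fin_succ, hA, hB, hC, hD]
  · simp [Fin.forall_fin_succ, hAB, hAC, hAD, hBC, hBD, hCD, hAB.symm, hAC.symm, hAD.symm,
      hBC.symm, hBD.symm, hCD.symm]
  · simp [Fin.forall_fin_succ, tAB, tAC, tAD, tBC, tBD, tCD, tAB.symm, tAC.symm, tAD.symm,
      tBC.symm, tBD.symm, tCD.symm]

theorem isMinor_K23_of_touch {X Y A B C : Set V} (hX : (G.induce X).Connected)
    (hY : (G.induce Y).Connected) (hA : (G.induce A).Connected) (hB : (G.induce B).Connected)
    (hC : (G.induce C).Connected) (hXY : Disjoint X Y) (hAB : Disjoint A B) (hAC : Disjoint A C)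
    (hBC : Disjoint B C) (hXA : Disjoint X A) (hXB : Disjoint X B) (hXC : Disjoint X C)
    (hYA : Disjoint Y A) (hYB : Disjoint Y B) (hYC : Disjoint Y C)
    (tXA : Touch G X A) (tXB : Touch G X B) (tXC : Touch G X C) (tYA : Touch G Y A)
    (tYB : Touch G Y B) (tYC : Touch G Y C) :
    IsMinor (completeBipartiteGraph (Fin 2) (Fin 3)) G := by
  refine ⟨Sum.elim ![X, Y] ![A, B, C], ?_, ?_, ?_⟩
  · simp [Fin.forall_fin_succ, hX, hY, hA, hB, hC]
  · simp [Fin.forall_fin_succ, hXY, hAB, hAC, hBC, hXA, hXB, hXC, hYA, hYB, hYC, hXY.symm,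
      hAB.symm, hAC.symm, hBC.symm, hXA.symm, hXB.symm, hXC.symm, hYA.symm, hYB.symm, hYC.symm]
  · simp [Fin.forall_fin_succ, tXA, tXB, tXC, tYA, tYB, tYC, tXA.symm, tXB.symm, tXC.symm,
      tYA.symm, tYB.symm, tYC.symm]

end ExcludedMinors

section Attachments

variable {V : Type*} {G : SimpleGraph V} {U R : Set V} {b c : V}

/-- `U` is a connected part of the graph which the vertices `c` and `b` separate from the rest, no
proper part of `U` can be separated from the rest by two adjacent vertices, and `c` and `b` are
also joined outside `U`, through the connected set `R`. -/
structure IsAttached (G : SimpleGraph V) (U R : Set V) (c b : V) : Prop where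
  connected_left : (G.induce U).Connected
  connected_right : (G.induce R).Connected
  disjoint : Disjoint U R
  notMem_left : c ∉ U
  notMem_right : c ∉ R
  touch : Touch G {c} R
  mem_right : b ∈ R
  boundary_subset : boundary G U ⊆ {c, b}
  not_boundary_subset : ∀ K, K.Nonempty → K ⊂ U → ∀ x y, G.Adj x y → ¬ boundary G K ⊆ {x, y}

theorem IsAttached.touch_of_disjoint_boundary (h : IsAttached G U R c b) {K : Set V} {w : V}
    (hw : w ∈ U) (hcw : G.Adj c w) (hK : K.Nonempty) (hKU : K ⊆ U \ {w})
    (hKb : Disjoint (boundary G K) (U \ {w})) : Touch G K {w} ∧ Touch G K R := by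
  have hKU' : K ⊂ U := ⟨hKU.trans Set.sdiff_subset, fun hUK => (hKU (hUK hw)).2 rfl⟩
  have hboundary {v : V} (hv : v ∈ boundary G K) (hvU : v ∈ U) : v = w := by
    by_contra hvw
    exact Set.disjoint_left.1 hKb hv ⟨hvU, hvw⟩
  constructor
  · obtain ⟨v, hv, hvU⟩ : ∃ v ∈ boundary G K, v ∈ U := by
      by_contra! hdisj
      exact hKU'.ne (eq_of_preconnected_of_disjoint_boundary h.connected_left.preconnected hK
        hKU'.subset (Set.disjoint_left.2 hdisj))
    exact hboundary hv hvU ▸ touch_of_mem_boundary hv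
  · obtain ⟨r, hr, hrcw⟩ := Set.not_subset.1 (h.not_boundary_subset K hK hKU' c w hcw)
    simp only [Set.mem_insert_iff, Set.mem_singleton_iff, not_or] at hrcw
    obtain ⟨u, hu, hur⟩ := hr.2
    have hrU : r ∉ U := fun hrU => hrcw.2 (hboundary hr hrU)
    obtain rfl := (h.boundary_subset ⟨hrU, u, hKU'.subset hu, hur⟩).resolve_left hrcw.1
    exact ⟨u, hu, r, h.mem_right, hur⟩

theorem IsAttached.preconnected_induce_diff (hG : IsOuterplanarMinorFree G)
    (h : IsAttached G U R c b) {w : V} (hw : w ∈ U) (hcw : G.Adj c w) :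
    (G.induce (U \ {w})).Preconnected := by
  by_contra hdisconn
  obtain ⟨K, hKU, L, hLU, hKL, hK, hL, hKb, hLb⟩ :=
    exists_disjoint_connected_of_not_preconnected hdisconn
  obtain ⟨tKw, tKR⟩ := h.touch_of_disjoint_boundary hw hcw (Set.nonempty_coe_sort.1 hK.nonempty)
    hKU hKb
  obtain ⟨tLw, tLR⟩ := h.touch_of_disjoint_boundary hw hcw (Set.nonempty_coe_sort.1 hL.nonempty)
    hLU hLb
  have hwR : w ∉ R := Set.disjoint_left.1 h.disjoint hw
  have hpart {S : Set V} (hS : S ⊆ U \ {w}) : Disjoint S {c} ∧ w ∉ S ∧ Disjoint R S :=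
    ⟨Set.disjoint_singleton_right.2 fun hc => h.notMem_left (hS hc).1, fun hwS => (hS hwS).2 rfl,
      (h.disjoint.mono_left (hS.trans Set.sdiff_subset)).symm⟩
  obtain ⟨hKc, hwK, hRK⟩ := hpart hKU
  obtain ⟨hLc, hwL, hRL⟩ := hpart hLU
  exact hG.2 <| isMinor_K23_of_touch (X := {w}) (connected_induce_singleton w) h.connected_right
    hK hL (connected_induce_singleton c) (Set.disjoint_singleton_left.2 hwR) hKL hKc hLc
    (Set.disjoint_singleton_left.2 hwK) (Set.disjoint_singleton_left.2 hwL)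
    (Set.disjoint_singleton.2 hcw.ne') hRK hRL (Set.disjoint_singleton_right.2 h.notMem_right)
    tKw.symm tLw.symm ⟨w, rfl, c, rfl, hcw.symm⟩ tKR.symm tLR.symm h.touch.symm

theorem IsAttached.not_touch_of_adj (hG : IsOuterplanarMinorFree G) (h : IsAttached G U R c b)
    {w w' : V} (hw : w ∈ U) (hw' : w' ∈ U) (hcw : G.Adj c w) (hcw' : G.Adj c w') (hne : w ≠ w') :
    ¬ Touch G {w} R := fun hwR => by
  have hwU : w' ∈ U \ {w} := ⟨hw', hne.symm⟩
  have hconn : (G.induce (U \ {w})).Connected :=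
    (connected_iff _).2 ⟨h.preconnected_induce_diff hG hw hcw, ⟨⟨w', hwU⟩⟩⟩
  obtain ⟨tw, tR⟩ := h.touch_of_disjoint_boundary hw hcw ⟨w', hwU⟩ subset_rfl
    (Set.disjoint_left.2 fun _ hv => hv.1)
  exact hG.1 <| isMinor_K4_of_touch (A := {c}) (B := {w}) (C := U \ {w}) (D := R)
    (connected_induce_singleton c) (connected_induce_singleton w) hconn h.connected_right
    (Set.disjoint_singleton.2 hcw.ne)
    (Set.disjoint_singleton_left.2 fun hc => h.notMem_left hc.1)
    (Set.disjoint_singleton_left.2 h.notMem_right) Set.disjoint_sdiff_right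
    (h.disjoint.mono_left (Set.singleton_subset_iff.2 hw))
    (h.disjoint.mono_left Set.sdiff_subset)
    ⟨c, rfl, w, rfl, hcw⟩ ⟨c, rfl, w', hwU, hcw'⟩ h.touch tw.symm hwR tR

theorem IsAttached.eq_of_adj (hG : IsOuterplanarMinorFree G) (h : IsAttached G U R c b) {w w' : V}
    (hw : w ∈ U) (hw' : w' ∈ U) (hcw : G.Adj c w) (hcw' : G.Adj c w') : w = w' := by
  by_contra hne
  have hwR' := h.not_touch_of_adj hG hw' hw hcw' hcw (Ne.symm hne)
  obtain ⟨-, t, ⟨htU, htw⟩, r, hr, htr⟩ := h.touch_of_disjoint_boundary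
    (K := U \ {w}) hw hcw ⟨w', hw', Ne.symm hne⟩ subset_rfl (Set.disjoint_left.2 fun _ hv => hv.1)
  have htw' : t ≠ w' := fun htw' => hwR' ⟨t, htw', r, hr, htr⟩
  obtain ⟨Z, hZU, htZ, hZ, hZb⟩ := exists_connected_disjoint_boundary (G := G)
    (A := (U \ {w}) \ {w'}) ⟨⟨htU, htw⟩, htw'⟩
  have tZ {x y : V} (hx : x ∈ U) (hcx : G.Adj c x) (hy : y ∈ U \ {x})
      (hZx : Z ⊆ (U \ {x}) \ {y}) (hZbx : Disjoint (boundary G Z) ((U \ {x}) \ {y})) :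
      Touch G Z {y} := by
    obtain ⟨v, hv, hvU⟩ : ∃ v ∈ boundary G Z, v ∈ U \ {x} := by
      by_contra! hdisj
      have hZU := eq_of_preconnected_of_disjoint_boundary (h.preconnected_induce_diff hG hx hcx)
        ⟨t, htZ⟩ (hZx.trans Set.sdiff_subset) (Set.disjoint_left.2 hdisj)
      exact (hZx (hZU ▸ hy)).2 rfl
    obtain rfl : v = y := by
      by_contra hvy
      exact Set.disjoint_left.1 hZbx hv ⟨hvU, hvy⟩
    exact touch_of_mem_boundary hv
  have tZw' := tZ hw hcw ⟨hw', Ne.symm hne⟩ hZU hZb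
  rw [Set.sdiff_sdiff_comm] at hZU hZb
  have tZw := tZ hw' hcw' ⟨hw, hne⟩ hZU hZb
  exact hG.2 <| isMinor_K23_of_touch (X := {c}) (Y := Z) (A := {w}) (B := {w'}) (C := R)
    (connected_induce_singleton c) hZ (connected_induce_singleton w)
    (connected_induce_singleton w') h.connected_right
    (Set.disjoint_singleton_left.2 fun hc => h.notMem_left (hZU hc).1.1)
    (Set.disjoint_singleton.2 hne)
    (h.disjoint.mono_left (Set.singleton_subset_iff.2 hw))
    (h.disjoint.mono_left (Set.singleton_subset_iff.2 hw')) (Set.disjoint_singleton.2 hcw.ne)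
    (Set.disjoint_singleton.2 hcw'.ne) (Set.disjoint_singleton_left.2 h.notMem_right)
    (Set.disjoint_singleton_right.2 fun hwZ => (hZU hwZ).2 rfl)
    (Set.disjoint_singleton_right.2 fun hwZ => (hZU hwZ).1.2 rfl)
    (h.disjoint.mono_left fun v hv => (hZU hv).1.1)
    ⟨c, rfl, w, rfl, hcw⟩ ⟨c, rfl, w', rfl, hcw'⟩ h.touch tZw tZw' ⟨t, htZ, r, hr, htr⟩

end Attachments

section CliqueEnds

variable {V : Type*} {G : SimpleGraph V} {U R T : Set V} {b c s : V}

theorem IsAttached.step (hG : IsOuterplanarMinorFree G) (h : IsAttached G U R c b) (hs : s ∈ U)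
    (hcs : G.Adj c s) (hne : (U \ {s}).Nonempty) :
    IsAttached G (U \ {s}) (insert c R) s b where
  connected_left :=
    (connected_iff _).2 ⟨h.preconnected_induce_diff hG hs hcs, hne.to_subtype⟩
  connected_right :=
    connected_induce_union_of_touch (connected_induce_singleton c) h.connected_right h.touch
  disjoint := Set.disjoint_insert_right.2
    ⟨fun hc => h.notMem_left hc.1, h.disjoint.mono_left Set.sdiff_subset⟩
  notMem_left hs' := hs'.2 rfl
  notMem_right := not_or.2 ⟨hcs.ne', Set.disjoint_left.1 h.disjoint hs⟩
  touch := ⟨s, rfl, c, Set.mem_insert c R, hcs.symm⟩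
  mem_right := Set.mem_insert_of_mem c h.mem_right
  boundary_subset := by
    rintro v ⟨hvU, u, hu, huv⟩
    by_cases hv : v ∈ U
    · left
      by_contra hvs
      exact hvU ⟨hv, hvs⟩
    · refine .inr ((h.boundary_subset ⟨hv, u, hu.1, huv⟩).resolve_left ?_)
      rintro rfl
      exact hu.2 (h.eq_of_adj hG hu.1 hs huv.symm hcs)
  not_boundary_subset K hK hKU :=
    h.not_boundary_subset K hK (hKU.trans_subset Set.sdiff_subset)

theorem IsAttached.neighborSet_eq (hG : IsOuterplanarMinorFree G) (h : IsAttached G U R c b)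
    (hs : s ∈ U) (hcs : G.Adj c s) (hdeg : (G.neighborSet s).Nontrivial) :
    G.neighborSet s = {c, b} ∨
      ∃ w ∈ U \ {s}, G.neighborSet s = {c, w} ∧ IsAttached G (U \ {s}) (insert c R) s b := by
  have heq {w : V} (hsub : G.neighborSet s ⊆ {c, w}) : G.neighborSet s = {c, w} := by
    rcases Set.subset_pair_iff_eq.1 hsub with h' | h' | h' | h'
    all_goals first | exact h' | simp [h'] at hdeg
  rcases Set.eq_empty_or_nonempty (U \ {s}) with hU | hne
  · refine .inl (heq fun v hv => h.boundary_subset ⟨fun hvU => ?_, s, hs, hv⟩)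
    exact (hU.subset ⟨hvU, hv.ne'⟩).elim
  · have hstep := h.step hG hs hcs hne
    have hsb : ¬ G.Adj s b := fun hsb => h.not_boundary_subset _ hne
      ⟨Set.sdiff_subset, fun hU => (hU hs).2 rfl⟩ s b hsb hstep.boundary_subset
    have hnbr {v : V} (hv : G.Adj s v) (hvc : v ≠ c) : v ∈ U \ {s} := by
      refine ⟨?_, hv.ne'⟩
      by_contra hvU
      rcases h.boundary_subset ⟨hvU, s, hs, hv⟩ with rfl | rfl
      exacts [hvc rfl, hsb hv]
    obtain ⟨w, hw, hwc⟩ := hdeg.exists_ne c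
    refine .inr ⟨w, hnbr hw hwc, heq fun v hv => ?_, hstep⟩
    by_cases hvc : v = c
    exacts [.inl hvc, .inr (hstep.eq_of_adj hG (hnbr hv hvc) (hnbr hw hwc) hv hw)]

/-- A nonempty set which is separated from the rest of the graph by a clique. The minimal such sets
are the ends at which an outerplanar graph can be reduced. -/
def IsCliqueEnd (G : SimpleGraph V) (T : Set V) : Prop :=
  T.Nonempty ∧ G.IsClique (boundary G T)

theorem exists_minimal_isCliqueEnd [Finite V] [Nonempty V] (G : SimpleGraph V) :
    ∃ T, Minimal (IsCliqueEnd G) T :=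
  (Set.toFinite {T | IsCliqueEnd G T}).exists_minimal
    ⟨Set.univ, Set.univ_nonempty, fun _ hv => (hv.1 trivial).elim⟩

theorem connected_of_minimal_isCliqueEnd (hT : Minimal (IsCliqueEnd G) T) :
    (G.induce T).Connected := by
  obtain ⟨s, hs⟩ := hT.prop.1
  obtain ⟨K, hKT, hsK, hK, hKb⟩ := exists_connected_disjoint_boundary (G := G) hs
  have hKend : IsCliqueEnd G K :=
    ⟨⟨s, hsK⟩, hT.prop.2.subset (boundary_subset_of_disjoint hKT hKb)⟩
  rwa [← hT.eq_of_subset hKend hKT]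

theorem boundary_nontrivial_of_minimal_isCliqueEnd (hT : Minimal (IsCliqueEnd G) T)
    (hdeg : ∀ v, (G.neighborSet v).Nontrivial) : (boundary G T).Nontrivial := by
  by_contra hb
  rw [Set.not_nontrivial_iff] at hb
  obtain ⟨s, hs, hsb⟩ : ∃ s ∈ T, ∀ v ∈ boundary G T, G.Adj s v := by
    rcases hb.eq_empty_or_singleton with hb | ⟨v, hb⟩
    · exact hT.prop.1.imp fun s hs => ⟨hs, by simp [hb]⟩
    · obtain ⟨-, s, hs, hsv⟩ : v ∈ boundary G T := hb ▸ rfl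
      exact ⟨s, hs, by simpa [hb] using hsv⟩
  have hsub : boundary G (T \ {s}) ⊆ insert s (boundary G T) := fun v hv => by
    obtain ⟨u, hu, huv⟩ := hv.2
    by_cases hvs : v = s
    exacts [.inl hvs, .inr ⟨fun hvT => hv.1 ⟨hvT, hvs⟩, u, hu.1, huv⟩]
  have hne : (T \ {s}).Nonempty := by
    by_contra! hT'
    have hnbr {v : V} (hv : G.Adj s v) : v ∈ boundary G T :=
      ⟨fun hvT => (hT'.subset ⟨hvT, hv.ne'⟩).elim, s, hs, hv⟩
    exact Set.not_nontrivial_iff.2 (hb.anti fun _ => hnbr) (hdeg s)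
  have hend : IsCliqueEnd G (T \ {s}) :=
    ⟨hne, (hT.prop.2.insert fun v hv _ => hsb v hv).subset hsub⟩
  exact (hT.le_of_le hend Set.sdiff_subset hs).2 rfl

theorem exists_isAttached [Finite V] [Nonempty V] (hG : IsOuterplanarMinorFree G)
    (hdeg : ∀ v, (G.neighborSet v).Nontrivial) :
    ∃ U a b, ∃ s ∈ U, G.Adj a s ∧ G.Adj a b ∧ IsAttached G U {b} a b := by
  obtain ⟨T, hT⟩ := exists_minimal_isCliqueEnd G
  have hconn := connected_of_minimal_isCliqueEnd hT
  obtain ⟨a, ha, b, hb, hab⟩ := boundary_nontrivial_of_minimal_isCliqueEnd hT hdeg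
  have hadj : G.Adj a b := hT.prop.2 ha hb hab
  have hsub : boundary G T ⊆ {a, b} := fun d hd => by
    by_contra hd'
    simp only [Set.mem_insert_iff, Set.mem_singleton_iff, not_or] at hd'
    exact hG.1 <| isMinor_K4_of_touch (A := {a}) (B := {b}) (C := {d}) (D := T)
      (connected_induce_singleton a) (connected_induce_singleton b) (connected_induce_singleton d)
      hconn (Set.disjoint_singleton.2 hab) (Set.disjoint_singleton.2 (Ne.symm hd'.1))
      (Set.disjoint_singleton_left.2 ha.1) (Set.disjoint_singleton.2 (Ne.symm hd'.2))
      (Set.disjoint_singleton_left.2 hb.1) (Set.disjoint_singleton_left.2 hd.1)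
      ⟨a, rfl, b, rfl, hadj⟩ ⟨a, rfl, d, rfl, hT.prop.2 ha hd (Ne.symm hd'.1)⟩
      (touch_of_mem_boundary ha).symm ⟨b, rfl, d, rfl, hT.prop.2 hb hd (Ne.symm hd'.2)⟩
      (touch_of_mem_boundary hb).symm (touch_of_mem_boundary hd).symm
  obtain ⟨s, hs, hsa⟩ := ha.2
  refine ⟨T, a, b, s, hs, hsa.symm, hadj, hconn, connected_induce_singleton b,
    Set.disjoint_singleton_right.2 hb.1, ha.1, hab, ⟨a, rfl, b, rfl, hadj⟩, rfl, hsub,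
    fun K hK hKT x y hxy hKxy => hKT.not_subset (hT.le_of_le ⟨hK, ?_⟩ hKT.subset)⟩
  exact (isClique_pair.2 fun _ => hxy).subset hKxy

theorem exists_neighborSet_eq_pair [Finite V] [Nonempty V] (hG : IsOuterplanarMinorFree G)
    (hdeg : ∀ v, (G.neighborSet v).Nontrivial) :
    ∃ u x v, G.neighborSet u = {x, v} ∧ (G.Adj x v ∨ ∃ y, G.neighborSet v = {u, y}) := by
  obtain ⟨U, a, b, s, hs, has, hab, h⟩ := exists_isAttached hG hdeg
  obtain hNs | ⟨w, hw, hNs, h'⟩ := h.neighborSet_eq hG hs has (hdeg s)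
  · exact ⟨s, a, b, hNs, .inl hab⟩
  · have hsw : w ∈ G.neighborSet s := hNs ▸ .inr rfl
    obtain hNw | ⟨y, -, hNw, -⟩ := h'.neighborSet_eq hG hw hsw (hdeg w)
    exacts [⟨s, a, w, hNs, .inr ⟨b, hNw⟩⟩, ⟨s, a, w, hNs, .inr ⟨y, hNw⟩⟩]

end CliqueEnds

/-! ### Packings -/

section Cores

variable {V W : Type*} {G : SimpleGraph V} {H : SimpleGraph W} {B : Finset V}

/-- A nonempty set of vertices that induces a subgraph of minimum degree at least two. Such a set
supports a cycle; unlike a cycle it survives the reductions without rerouting a walk. -/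
def IsCore (G : SimpleGraph V) (B : Finset V) : Prop :=
  B.Nonempty ∧ ∀ v ∈ B, (G.neighborSet v ∩ B).Nontrivial

theorem not_isAcyclic_of_nontrivial_neighborSet [Finite V] [Nonempty V]
    (h : ∀ v, (G.neighborSet v).Nontrivial) : ¬ G.IsAcyclic := fun hG => by
  classical
  obtain ⟨r⟩ := ‹Nonempty V›
  let C := G.connectedComponentMk r
  have hmem {v w : V} (hv : v ∈ C) (hvw : G.Adj v w) : w ∈ C :=
    (ConnectedComponent.connectedComponentMk_eq_of_adj hvw).symm.trans hv
  obtain ⟨s, hs⟩ := (h r).nonempty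
  have : Nontrivial C := ⟨⟨r, rfl⟩, ⟨s, hmem rfl hs⟩, fun hrs => hs.ne (congrArg Subtype.val hrs)⟩
  have := Fintype.ofFinite C
  obtain ⟨v, hv⟩ := (hG.isTree_connectedComponent C).exists_vert_degree_one_of_nontrivial
  obtain ⟨w, -, huniq⟩ := degree_eq_one_iff_existsUnique_adj.1 hv
  obtain ⟨x, hx, hxw⟩ := (h v).exists_ne w
  exact hxw (congrArg Subtype.val (huniq ⟨x, hmem v.2 hx⟩ hx))

theorem IsCore.exists_isCycle (hB : IsCore G B) :
    ∃ H : G.Subgraph, (∃ (v : V) (p : G.Walk v v), p.IsCycle ∧ p.toSubgraph = H) ∧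
      H.verts.Nonempty ∧ H.verts ⊆ B := by
  have : Nonempty (B : Set V) := hB.1.to_subtype
  have hcyc : ¬ (G.induce (B : Set V)).IsAcyclic := by
    refine not_isAcyclic_of_nontrivial_neighborSet fun v => ?_
    obtain ⟨x, ⟨hx, hxB⟩, y, ⟨hy, hyB⟩, hxy⟩ := hB.2 v v.2
    exact ⟨⟨x, hxB⟩, hx, ⟨y, hyB⟩, hy, fun h => hxy (congrArg Subtype.val h)⟩
  simp only [IsAcyclic, not_forall, not_not] at hcyc
  obtain ⟨v, p, hp⟩ := hcyc
  let f : G.induce (B : Set V) ↪g G := Embedding.induce (B : Set V)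
  refine ⟨(p.map f.toHom).toSubgraph, ⟨_, _, hp.map f.injective, rfl⟩,
    ⟨f v, Walk.start_mem_verts_toSubgraph _⟩, fun z hz => ?_⟩
  rw [Walk.mem_verts_toSubgraph, Walk.support_map, List.mem_map] at hz
  obtain ⟨w, -, rfl⟩ := hz
  exact w.2

theorem exists_isDisjointCycleCollection {C : Finset (Finset V)} (hC : ∀ B ∈ C, IsCore G B)
    (hd : (C : Set (Finset V)).PairwiseDisjoint id) :
    ∃ D : Finset G.Subgraph, G.IsDisjointCycleCollection D ∧ D.card = C.card := by
  classical
  choose! F hF hFne hFB using fun B hB => (hC B hB).exists_isCycle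
  have hdisj : (C : Set (Finset V)).Pairwise fun B B' => Disjoint (F B).verts (F B').verts :=
    fun B hB B' hB' hne => Set.disjoint_of_subset (hFB B hB) (hFB B' hB')
      (Finset.disjoint_coe.2 (hd hB hB' hne))
  have hinj : Set.InjOn F C := fun B hB B' hB' heq => by
    by_contra hne
    exact (hFne B' hB').ne_empty (disjoint_self.1 (by simpa only [heq] using hdisj hB hB' hne))
  refine ⟨C.image F, ⟨?_, ?_⟩, Finset.card_image_of_injOn hinj⟩
  · exact Finset.forall_mem_image.2 hF
  · rw [Finset.coe_image]
    rintro _ ⟨B, hB, rfl⟩ _ ⟨B', hB', rfl⟩ hne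
    exact hdisj hB hB' (ne_of_apply_ne F hne)

theorem IsCore.map {B : Finset W} (hB : IsCore H B) (f : H ↪g G) :
    IsCore G (B.map f.toEmbedding) := by
  refine ⟨hB.1.map, Finset.forall_mem_map.2 fun w hw => ?_⟩
  refine ((hB.2 w hw).image f.injective).mono ?_
  rintro _ ⟨x, ⟨hwx, hx⟩, rfl⟩
  exact ⟨f.map_adj_iff.2 hwx, Finset.mem_map_of_mem _ hx⟩

end Cores

section Packings

variable {V W : Type*} {G : SimpleGraph V} {H : SimpleGraph W} {B I : Finset V}
  {C : Finset (Finset V)} {u v x y : V}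

/-- An independent set together with a family of disjoint cores, from which the disjoint cycles
will be taken. -/
structure IsPacking (G : SimpleGraph V) (I : Finset V) (C : Finset (Finset V)) : Prop where
  isIndepSet : G.IsIndepSet (I : Set V)
  isCore : ∀ B ∈ C, IsCore G B
  pairwiseDisjoint : (C : Set (Finset V)).PairwiseDisjoint id

theorem IsPacking.map {I : Finset W} {C : Finset (Finset W)} (h : IsPacking H I C) (f : H ↪g G) :
    IsPacking G (I.map f.toEmbedding) (C.map (Finset.mapEmbedding f.toEmbedding).toEmbedding) where
  isIndepSet := by
    rw [Finset.coe_map]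
    rintro _ ⟨x, hx, rfl⟩ _ ⟨y, hy, rfl⟩ hxy hadj
    exact h.isIndepSet hx hy (ne_of_apply_ne f hxy) (f.map_adj_iff.1 hadj)
  isCore := Finset.forall_mem_map.2 fun B hB => (h.isCore B hB).map f
  pairwiseDisjoint := by
    rw [Finset.coe_map]
    rintro _ ⟨B, hB, rfl⟩ _ ⟨B', hB', rfl⟩ hne
    exact (Finset.disjoint_map _).2 (h.pairwiseDisjoint hB hB' (ne_of_apply_ne _ hne))

theorem adj_of_sup_edge_adj (h : (G ⊔ edge x y).Adj u v) (hne : s(u, v) ≠ s(x, y)) :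
    G.Adj u v := by
  rcases h with h | h
  exacts [h, (hne (by simpa using ((edge_adj ..).1 h).1)).elim]

theorem IsPacking.of_sup_edge (h : IsPacking (G ⊔ edge x y) I C)
    (hxy : ∀ B ∈ C, x ∈ B → y ∉ B) : IsPacking G I C where
  isIndepSet := fun _ ha _ hb hne hab => h.isIndepSet ha hb hne (.inl hab)
  isCore B hB := by
    refine ⟨(h.isCore B hB).1, fun w hw => ((h.isCore B hB).2 w hw).mono fun z hz => ⟨?_, hz.2⟩⟩
    refine adj_of_sup_edge_adj hz.1 fun hwz => ?_
    rcases Sym2.eq_iff.1 hwz with ⟨rfl, rfl⟩ | ⟨rfl, rfl⟩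
    exacts [hxy B hB hw hz.2, hxy B hB hz.2 hw]
  pairwiseDisjoint := h.pairwiseDisjoint

variable [DecidableEq V]

theorem IsPacking.insert_vertex (h : IsPacking G I C) (hv : ∀ w ∈ I, ¬ G.Adj v w) :
    IsPacking G (insert v I) C where
  isIndepSet := by
    rw [Finset.coe_insert]
    exact Set.Pairwise.insert h.isIndepSet fun w hw _ => ⟨hv w hw, fun hwv => hv w hw hwv.symm⟩
  isCore := h.isCore
  pairwiseDisjoint := h.pairwiseDisjoint

theorem IsPacking.insert_core (h : IsPacking G I C) (hB : IsCore G B)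
    (hd : ∀ B' ∈ C, Disjoint B B') : IsPacking G I (insert B C) where
  isIndepSet := h.isIndepSet
  isCore := (Finset.forall_mem_insert ..).2 ⟨hB, h.isCore⟩
  pairwiseDisjoint := by
    rw [Finset.coe_insert]
    exact h.pairwiseDisjoint.insert fun B' hB' _ => hd B' hB'

theorem nontrivial_neighborSet_insert_of_sup_edge (hxu : G.Adj x u) (huB : u ∉ B)
    (h : ((G ⊔ edge x y).neighborSet x ∩ B).Nontrivial) :
    (G.neighborSet x ∩ (insert u B : Finset V)).Nontrivial := by
  obtain ⟨z, ⟨hxz, hzB⟩, hzy⟩ := h.exists_ne y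
  refine ⟨u, ⟨hxu, by simp⟩, z, ⟨adj_of_sup_edge_adj hxz ?_, by simp [hzB]⟩, ?_⟩
  · simp [hzy, Adj.ne' (G := G ⊔ edge x y) hxz]
  · rintro rfl
    exact huB hzB

theorem IsCore.insert_insert_of_sup_edge (hB : IsCore (G ⊔ edge x y) B) (hx : x ∈ B) (hy : y ∈ B)
    (huB : u ∉ B) (hvB : v ∉ B) (hxu : G.Adj x u) (huv : G.Adj u v) (hvy : G.Adj v y) :
    IsCore G (insert u (insert v B)) := by
  have hxv : x ≠ v := fun h => hvB (h ▸ hx)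
  have huy : u ≠ y := fun h => huB (h ▸ hy)
  refine ⟨Finset.insert_nonempty .., fun w hw => ?_⟩
  rw [Finset.mem_insert, Finset.mem_insert] at hw
  rcases hw with rfl | rfl | hw
  · exact ⟨x, ⟨hxu.symm, by simp [hx]⟩, v, ⟨huv, by simp⟩, hxv⟩
  · exact ⟨u, ⟨huv.symm, by simp⟩, y, ⟨hvy, by simp [hy]⟩, huy⟩
  by_cases hwx : w = x
  · subst hwx
    refine (nontrivial_neighborSet_insert_of_sup_edge hxu huB (hB.2 w hw)).mono ?_
    exact Set.inter_subset_inter_right _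
      (Finset.coe_subset.2 (Finset.insert_subset_insert _ (Finset.subset_insert ..)))
  by_cases hwy : w = y
  · subst hwy
    have hdeg := hB.2 w hw
    rw [edge_comm] at hdeg
    refine (nontrivial_neighborSet_insert_of_sup_edge hvy.symm hvB hdeg).mono ?_
    exact Set.inter_subset_inter_right _ (Finset.coe_subset.2 (Finset.subset_insert ..))
  · refine (hB.2 w hw).mono fun z hz => ⟨adj_of_sup_edge_adj hz.1 ?_, ?_⟩
    · simp [hwx, hwy]
    · exact Finset.mem_insert_of_mem (Finset.mem_insert_of_mem hz.2)

end Packings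

section Reduction

variable {V : Type*} {G : SimpleGraph V} {I : Finset V} {C : Finset (Finset V)} {u v x y : V}

theorem IsPacking.exists_of_sup_edge (h : IsPacking (G ⊔ edge x y) I C)
    (hu : ∀ B ∈ C, u ∉ B) (hv : ∀ B ∈ C, v ∉ B) (hxu : G.Adj x u) (huv : G.Adj u v)
    (hvy : G.Adj v y) : ∃ C' : Finset (Finset V), IsPacking G I C' ∧ C'.card = C.card := by
  classical
  by_cases hxy : ∃ B ∈ C, x ∈ B ∧ y ∈ B
  · obtain ⟨B, hB, hx, hy⟩ := hxy
    have hdisj (B') (hB' : B' ∈ C.erase B) : Disjoint B B' :=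
      h.pairwiseDisjoint hB (Finset.mem_of_mem_erase hB') (Finset.ne_of_mem_erase hB').symm
    have herase : IsPacking (G ⊔ edge x y) I (C.erase B) :=
      ⟨h.isIndepSet, fun B' hB' => h.isCore B' (Finset.mem_of_mem_erase hB'),
        h.pairwiseDisjoint.subset (Finset.coe_subset.2 (Finset.erase_subset ..))⟩
    refine ⟨insert (insert u (insert v B)) (C.erase B), IsPacking.insert_core
      (herase.of_sup_edge fun B' hB' hxB' => (Finset.disjoint_left.1 (hdisj B' hB') hx hxB').elim)
      ((h.isCore B hB).insert_insert_of_sup_edge hx hy (hu B hB) (hv B hB) hxu huv hvy)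
      fun B' hB' => ?_, ?_⟩
    · simp [hdisj B' hB', hu B' (Finset.mem_of_mem_erase hB'), hv B' (Finset.mem_of_mem_erase hB')]
    · rw [Finset.card_insert_of_notMem, Finset.card_erase_add_one hB]
      exact fun hmem => hu _ (Finset.mem_of_mem_erase hmem) (Finset.mem_insert_self ..)
  · exact ⟨C, h.of_sup_edge fun B hB hx hy => hxy ⟨B, hB, hx, hy⟩, rfl⟩

/-- The bound `9|I| + 3|C| ≥ 4n` holds for some packing of the finite graph `G`. -/
def IsPackable (G : SimpleGraph V) : Prop :=
  ∃ I C, IsPacking G I C ∧ 4 * Nat.card V ≤ 9 * I.card + 3 * C.card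

theorem IsPackable.exists_isPacking {S : Set V} (h : IsPackable (G.induce S)) :
    ∃ I C, IsPacking G I C ∧ (∀ w ∈ I, w ∈ S) ∧ (∀ B ∈ C, ∀ w ∈ B, w ∈ S) ∧
      4 * S.ncard ≤ 9 * I.card + 3 * C.card := by
  obtain ⟨I, C, hIC, hcard⟩ := h
  refine ⟨_, _, hIC.map (Embedding.induce S), ?_, ?_, by simpa using hcard⟩
  · exact Finset.forall_mem_map.2 fun w _ => w.2
  · exact Finset.forall_mem_map.2 fun B _ => Finset.forall_mem_map.2 fun w _ => w.2

theorem IsPackable.of_induce_compl_closedNeighborSet [Finite V]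
    (hv : (G.neighborSet v).Subsingleton)
    (h : IsPackable (G.induce (insert v (G.neighborSet v))ᶜ)) : IsPackable G := by
  classical
  obtain ⟨I, C, hIC, hI, -, hcard⟩ := h.exists_isPacking
  refine ⟨insert v I, C, hIC.insert_vertex fun w hw hvw => hI w hw (.inr hvw), ?_⟩
  have hvI : v ∉ I := fun hvI => hI v hvI (Set.mem_insert ..)
  have hle : (insert v (G.neighborSet v)).ncard ≤ 2 :=
    (Set.ncard_insert_le ..).trans (Nat.succ_le_succ (Set.ncard_le_one_iff_subsingleton.2 hv))
  have := Set.ncard_add_ncard_compl (insert v (G.neighborSet v))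
  rw [Finset.card_insert_of_notMem hvI]
  omega

theorem IsPackable.of_induce_compl_triangle [Finite V] (hu : G.neighborSet u = {x, v})
    (hxv : G.Adj x v) (h : IsPackable (G.induce {u, x, v}ᶜ)) : IsPackable G := by
  classical
  obtain ⟨I, C, hIC, hI, hC, hcard⟩ := h.exists_isPacking
  have hux : G.Adj u x := hu.ge (.inl rfl)
  have huv : G.Adj u v := hu.ge (.inr rfl)
  have hcore : IsCore G {u, x, v} := by
    refine ⟨by simp, ?_⟩
    simp only [Finset.mem_insert, Finset.mem_singleton, forall_eq_or_imp, forall_eq]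
    exact ⟨⟨x, by simp [hux], v, by simp [huv], hxv.ne⟩,
      ⟨u, by simp [hux.symm], v, by simp [hxv], huv.ne⟩,
      ⟨u, by simp [huv.symm], x, by simp [hxv.symm], hux.ne⟩⟩
  have hdisj (B) (hB : B ∈ C) : Disjoint {u, x, v} B :=
    Finset.disjoint_left.2 fun w hw hwB => hC B hB w hwB (by simpa using hw)
  refine ⟨insert u I, insert {u, x, v} C,
    (hIC.insert_core hcore hdisj).insert_vertex fun w hw huw => hI w hw ?_, ?_⟩
  · exact .inr (hu.le huw)
  have huI : u ∉ I := fun huI => hI u huI (by simp)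
  have huC : {u, x, v} ∉ C := fun hmem => hC _ hmem u (by simp) (by simp)
  have hle : ({u, x, v} : Set V).ncard ≤ 3 := by
    simpa using (Set.ncard_coe_finset {u, x, v}).trans_le Finset.card_le_three
  have := Set.ncard_add_ncard_compl {u, x, v}
  rw [Finset.card_insert_of_notMem huI, Finset.card_insert_of_notMem huC]
  omega

theorem IsPackable.of_bypass [Finite V] (hu : G.neighborSet u = {x, v})
    (hv : G.neighborSet v = {u, y}) (hxy : x ≠ y)
    (h : IsPackable ((G ⊔ edge x y).induce {u, v}ᶜ)) : IsPackable G := by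
  classical
  obtain ⟨I, C, hIC, hI, hC, hcard⟩ := h.exists_isPacking
  have hux : G.Adj u x := hu.ge (.inl rfl)
  have huv : G.Adj u v := hu.ge (.inr rfl)
  have hvy : G.Adj v y := hv.ge (.inr rfl)
  have huI : u ∉ I := fun huI => hI u huI (.inl rfl)
  have hvI : v ∉ I := fun hvI => hI v hvI (.inr rfl)
  obtain ⟨C', hIC', hC'⟩ := hIC.exists_of_sup_edge (fun B hB huB => hC B hB u huB (.inl rfl))
    (fun B hB hvB => hC B hB v hvB (.inr rfl)) hux.symm huv hvy
  have hle : ({u, v} : Set V).ncard ≤ 2 := by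
    simpa using (Set.ncard_coe_finset {u, v}).trans_le Finset.card_le_two
  have := Set.ncard_add_ncard_compl {u, v}
  obtain ⟨z, hzI, hz⟩ : ∃ z ∉ I, ∀ w ∈ I, ¬ G.Adj z w := by
    by_cases hxI : x ∈ I
    · refine ⟨v, hvI, fun w hw hvw => ?_⟩
      rcases hv.le hvw with rfl | rfl
      exacts [huI hw, hIC.isIndepSet hxI hw hxy (.inr (by simp [edge_adj, hxy]))]
    · refine ⟨u, huI, fun w hw huw => ?_⟩
      rcases hu.le huw with rfl | rfl
      exacts [hxI hw, hvI hw]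
  refine ⟨insert z I, C', hIC'.insert_vertex hz, ?_⟩
  rw [Finset.card_insert_of_notMem hzI]
  omega

theorem isMinor_induce (S : Set V) : IsMinor (G.induce S) G :=
  .of_isContained ⟨(Embedding.induce S).toCopy⟩

theorem isMinor_bypass (hxu : G.Adj x u) (huv : G.Adj u v) (hvy : G.Adj v y) :
    IsMinor ((G ⊔ edge x y).induce {u, v}ᶜ) G := by
  classical
  let r : V → V := Function.update (Function.update id u x) v y
  have hru : r u = x := by simp [r, huv.ne]
  have hrv : r v = y := by simp [r]
  have hr (z : ({u, v}ᶜ : Set V)) : r z = z := by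
    have hzu : (z : V) ≠ u := fun h => z.2 (.inl h)
    have hzv : (z : V) ≠ v := fun h => z.2 (.inr h)
    simp [r, hzu, hzv]
  refine ⟨fun z => r ⁻¹' {(z : V)}, fun z => ?_, fun z z' hne => ?_, ?_⟩
  · refine connected_iff_exists_forall_reachable _ |>.2 ⟨⟨z, hr z⟩, fun ⟨w, hw⟩ => ?_⟩
    by_cases hwz : w = z
    · simp [hwz]
    refine Adj.reachable (show G.Adj z w from ?_)
    have hz : r w = z := hw
    by_cases hwu : w = u
    · rwa [← hz, hwu, hru]
    by_cases hwv : w = v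
    · rw [← hz, hwv, hrv]
      exact hvy.symm
    · exact (hwz ((hr ⟨w, by simp [hwu, hwv]⟩).symm.trans hz)).elim
  · exact (Set.disjoint_singleton.2 fun h => hne (Subtype.ext h)).preimage r
  · intro z z' hzz'
    by_cases hxy : s((z : V), (z' : V)) = s(x, y)
    · rcases Sym2.eq_iff.1 hxy with ⟨hzx, hzy⟩ | ⟨hzy, hzx⟩
      · exact ⟨u, hru.trans hzx.symm, v, hrv.trans hzy.symm, huv⟩
      · exact ⟨v, hrv.trans hzy.symm, u, hru.trans hzx.symm, huv.symm⟩
    · exact ⟨z, hr z, z', hr z', adj_of_sup_edge_adj hzz' hxy⟩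

theorem isPackable_of_isOuterplanarMinorFree {V : Type*} [Finite V] {G : SimpleGraph V}
    (hG : IsOuterplanarMinorFree G) : IsPackable G := by
  induction hn : Nat.card V using Nat.strong_induction_on generalizing V with
  | _ n ih =>
  subst hn
  have hlt {S : Set V} (u : V) (hu : u ∈ S) : Nat.card ↥Sᶜ < Nat.card V := by
    simpa using Set.ncard_lt_card (s := Sᶜ) fun hS => (hS.ge trivial : u ∉ S) hu
  have hinduce {S : Set V} (u : V) (hu : u ∈ S) : IsPackable (G.induce Sᶜ) :=
    ih _ (hlt u hu) (hG.of_isMinor (isMinor_induce _)) rfl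
  rcases isEmpty_or_nonempty V with _ | _
  · exact ⟨∅, ∅, ⟨by simp [IsIndepSet], by simp, by simp⟩, by simp⟩
  by_cases hdeg : ∀ v, (G.neighborSet v).Nontrivial
  · obtain ⟨u, x, v, hu, hcase⟩ := exists_neighborSet_eq_pair hG hdeg
    by_cases hxv : G.Adj x v
    · exact .of_induce_compl_triangle hu hxv (hinduce u (.inl rfl))
    · obtain ⟨y, hv⟩ := hcase.resolve_left hxv
      have hux : G.Adj u x := hu.ge (.inl rfl)
      have huv : G.Adj u v := hu.ge (.inr rfl)
      have hvy : G.Adj v y := hv.ge (.inr rfl)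
      refine .of_bypass hu hv (fun hxy => hxv (hxy ▸ hvy.symm)) (ih _ (hlt u (.inl rfl)) ?_ rfl)
      exact hG.of_isMinor (isMinor_bypass hux.symm huv hvy)
  · push Not at hdeg
    obtain ⟨v, hv⟩ := hdeg
    exact .of_induce_compl_closedNeighborSet hv (hinduce v (Set.mem_insert ..))

end Reduction

/-! ### Tightness -/

section ParabolaDrawings

variable {V : Type*} {G : SimpleGraph V} {f : V → ℝ} {a b c d : ℝ} {z : ℝ × ℝ}

theorem not_isBounded_image_add_smul {E : Type*} [NormedAddCommGroup E] [NormedSpace ℝ E] (p : E)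
    {w : E} (hw : w ≠ 0) : ¬ Bornology.IsBounded ((fun t : ℝ => p + t • w) '' Set.Ioi 0) := by
  intro hbdd
  obtain ⟨M, hM, hle⟩ := hbdd.exists_pos_norm_le
  have hw' : 0 < ‖w‖ := norm_pos_iff.2 hw
  set t := (M + ‖p‖ + 1) / ‖w‖ with ht
  have htpos : 0 < t := by positivity
  have htw : ‖t • w‖ = M + ‖p‖ + 1 := by
    rw [norm_smul, Real.norm_of_nonneg htpos.le, ht, div_mul_cancel₀ _ hw'.ne']
  have hbound : ‖p + t • w‖ ≤ M := hle _ ⟨t, htpos, rfl⟩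
  have := norm_sub_le (p + t • w) p
  rw [add_sub_cancel_left] at this
  linarith

theorem point_mem_frontier_outerFace_of_ray (D : G.PlaneDrawing) {v : V} {w : ℝ × ℝ} (hw : w ≠ 0)
    (h : ∀ t : ℝ, 0 < t → D.point v + t • w ∉ D.carrier) : D.point v ∈ frontier D.outerFace := by
  let r : ℝ → ℝ × ℝ := fun t => D.point v + t • w
  have hr : Continuous r := by fun_prop
  have hsub : r '' Set.Ioi 0 ⊆ D.carrierᶜ := Set.image_subset_iff.2 h
  have hface (t : ℝ) (ht : 0 < t) : r t ∈ D.outerFace :=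
    ⟨h t ht, fun hbdd => not_isBounded_image_add_smul (D.point v) hw <| hbdd.subset <|
      (isPreconnected_Ioi.image r hr.continuousOn).subset_connectedComponentIn
        (Set.mem_image_of_mem r ht) hsub⟩
  have hlim : Filter.Tendsto r (nhdsWithin 0 (Set.Ioi 0)) (nhds (D.point v)) := by
    simpa [r] using (hr.tendsto 0).mono_left nhdsWithin_le_nhds
  rw [frontier_eq_closure_inter_closure]
  exact ⟨mem_closure_of_tendsto hlim (Filter.eventually_of_mem self_mem_nhdsWithin hface),
    subset_closure fun hv => hv.1 (.inl ⟨v, rfl⟩)⟩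

/-- The point with abscissa `t` on the parabola `y = x ^ 2`. -/
def parabola (t : ℝ) : ℝ × ℝ := (t, t ^ 2)

theorem parabola_injective : Function.Injective parabola :=
  fun _ _ h => congrArg Prod.fst h

theorem mem_segment_parabola (hz : z ∈ segment ℝ (parabola a) (parabola b)) :
    z.1 ∈ Set.uIcc a b ∧ z.2 = (a + b) * z.1 - a * b := by
  obtain ⟨s, t, hs, ht, hst, rfl⟩ := hz
  constructor
  · rw [← segment_eq_uIcc]
    exact ⟨s, t, hs, ht, hst, by simp [parabola]⟩
  · obtain rfl : s = 1 - t := by linarith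
    simp only [parabola, Prod.smul_mk, Prod.mk_add_mk, smul_eq_mul]
    ring

theorem sq_le_of_mem_segment_parabola (hz : z ∈ segment ℝ (parabola a) (parabola b)) :
    z.1 ^ 2 ≤ z.2 := by
  obtain ⟨hmem, heq⟩ := mem_segment_parabola hz
  rw [heq]
  rcases Set.mem_uIcc.1 hmem with ⟨hl, hr⟩ | ⟨hl, hr⟩ <;> nlinarith

theorem eq_or_eq_of_parabola_mem_segment (h : parabola c ∈ segment ℝ (parabola a) (parabola b)) :
    c = a ∨ c = b := by
  have heq : c ^ 2 = (a + b) * c - a * b := (mem_segment_parabola h).2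
  have hmul : (c - a) * (c - b) = 0 := by linear_combination heq
  simpa [sub_eq_zero] using hmul

theorem eq_parabola_of_mem_segment_of_mem_segment (hbc : b ≠ c)
    (hb : z ∈ segment ℝ (parabola a) (parabola b)) (hc : z ∈ segment ℝ (parabola a) (parabola c)) :
    z = parabola a := by
  have hzb := (mem_segment_parabola hb).2
  have hzc := (mem_segment_parabola hc).2
  have hmul : (b - c) * (z.1 - a) = 0 := by linear_combination hzc - hzb
  have hza : z.1 = a := sub_eq_zero.1 ((mul_eq_zero.1 hmul).resolve_left (sub_ne_zero.2 hbc))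
  refine Prod.ext hza ?_
  rw [hzb, hza]
  simp only [parabola]
  ring

theorem disjoint_segment_parabola (hab : a < b) (hcd : c < d) (hac : a < c) (hbd : b ≠ d)
    (hcross : c ≤ b → d ≤ b) :
    Disjoint (segment ℝ (parabola a) (parabola b)) (segment ℝ (parabola c) (parabola d)) := by
  refine Set.disjoint_left.2 fun z hz hz' => ?_
  obtain ⟨hmem, heq⟩ := mem_segment_parabola hz
  obtain ⟨hmem', heq'⟩ := mem_segment_parabola hz'
  rw [Set.uIcc_of_lt hab] at hmem
  rw [Set.uIcc_of_lt hcd] at hmem'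
  have hdb : d < b := (hcross (hmem'.1.trans hmem.2)).lt_of_ne hbd.symm
  have : (z.1 - c) * (d - z.1) < (z.1 - a) * (b - z.1) := by
    nlinarith [hmem'.1, hmem'.2]
  nlinarith

/-- No two edges `uv` and `xy` interlace when the vertices are placed on a line by `f`. -/
def IsNoncrossing (G : SimpleGraph V) (f : V → ℝ) : Prop :=
  ∀ ⦃u v x y⦄, G.Adj u v → G.Adj x y → f u < f x → f x < f v → f y ≤ f v

/-- The chord of the parabola between the two ends of an edge, placed at the abscissas `f`. -/
def chord (f : V → ℝ) : Sym2 V → Set (ℝ × ℝ) :=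
  Sym2.lift ⟨fun u v => segment ℝ (parabola (f u)) (parabola (f v)), fun _ _ => segment_symm ℝ _ _⟩

theorem exists_adj_lt_of_mem_edgeSet (hf : Function.Injective f) {e : Sym2 V}
    (he : e ∈ G.edgeSet) : ∃ u v, G.Adj u v ∧ f u < f v ∧ e = s(u, v) := by
  induction e using Sym2.ind with
  | _ u v =>
    rcases (hf.ne (G.ne_of_adj he)).lt_or_gt with h | h
    exacts [⟨u, v, he, h, rfl⟩, ⟨v, u, G.adj_symm he, h, Sym2.eq_swap⟩]

theorem IsNoncrossing.disjoint_chord (hG : IsNoncrossing G f) (hf : Function.Injective f)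
    {e e' : Sym2 V} (he : e ∈ G.edgeSet) (he' : e' ∈ G.edgeSet) (hee' : ∀ w ∈ e, w ∉ e') :
    Disjoint (chord f e) (chord f e') := by
  obtain ⟨u, v, huv, hfuv, rfl⟩ := exists_adj_lt_of_mem_edgeSet hf he
  obtain ⟨x, y, hxy, hfxy, rfl⟩ := exists_adj_lt_of_mem_edgeSet hf he'
  have hu := hee' u (Sym2.mem_mk_left ..)
  have hv := hee' v (Sym2.mem_mk_right ..)
  simp only [Sym2.mem_iff, not_or] at hu hv
  rcases (hf.ne hu.1).lt_or_gt with hux | hxu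
  · exact disjoint_segment_parabola hfuv hfxy hux (hf.ne hv.2)
      (fun hxv => hG huv hxy hux (hxv.lt_of_ne (hf.ne (Ne.symm hv.1))))
  · exact (disjoint_segment_parabola hfxy hfuv hxu (hf.ne (Ne.symm hv.2))
      (fun huy => hG hxy huv hxu (huy.lt_of_ne (hf.ne hu.2)))).symm

/-- The drawing with the vertices on the parabola and straight edges. -/
def parabolaDrawing (hG : IsNoncrossing G f) (hf : Function.Injective f) : G.PlaneDrawing where
  point v := parabola (f v)
  arc := chord f
  point_injective := parabola_injective.comp hf
  isArc u v huv := by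
    have hne : parabola (f u) ≠ parabola (f v) := (parabola_injective.comp hf).ne huv.ne
    refine ⟨Path.segment _ _, fun s t hst => ?_, by simp [chord]⟩
    exact Subtype.ext (AffineMap.lineMap_injective ℝ hne (by simpa using hst))
  mem_of_point_mem_arc e _ w hw := by
    induction e using Sym2.ind with
    | _ u v =>
      exact Sym2.mem_iff.2 ((eq_or_eq_of_parabola_mem_segment hw).imp (@hf _ _) (@hf _ _))
  arc_inter_arc e he e' he' hne z hz := by
    obtain ⟨w, hw, hw'⟩ : ∃ w ∈ e, w ∈ e' := by
      by_contra! hee'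
      exact Set.disjoint_left.1 (hG.disjoint_chord hf he he' hee') hz.1 hz.2
    refine ⟨w, hw, hw', ?_⟩
    obtain ⟨u, rfl⟩ := hw
    obtain ⟨v, rfl⟩ := hw'
    have hfuv : f u ≠ f v := hf.ne fun huv => hne (by rw [huv])
    exact eq_parabola_of_mem_segment_of_mem_segment hfuv hz.1 hz.2

theorem IsNoncrossing.isOuterplanar (hG : IsNoncrossing G f) (hf : Function.Injective f) :
    G.IsOuterplanar := by
  refine ⟨parabolaDrawing hG hf, fun v => ?_⟩
  refine point_mem_frontier_outerFace_of_ray _ (w := (0, -1)) (by simp) fun t ht hmem => ?_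
  have hcarrier : ∀ z ∈ (parabolaDrawing hG hf).carrier, z.1 ^ 2 ≤ z.2 := by
    rintro z (⟨u, rfl⟩ | hz)
    · exact le_rfl
    · obtain ⟨e, -, hz⟩ := Set.mem_iUnion₂.1 hz
      induction e using Sym2.ind with
      | _ u v => exact sq_le_of_mem_segment_parabola hz
  have := hcarrier _ hmem
  simp only [parabolaDrawing, parabola, Prod.smul_mk, Prod.mk_add_mk, smul_eq_mul] at this
  linarith

end ParabolaDrawings

section DisjointTriangles

theorem isNoncrossing_disjointTriangles (k : ℕ) :
    IsNoncrossing (disjointTriangles k) fun v => ((finProdFinEquiv v : ℕ) : ℝ) := by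
  intro u v x y huv hxy hux hxv
  have huv₁ : u.1 = v.1 := huv.1
  have hxy₁ : x.1 = y.1 := hxy.1
  simp only [Nat.cast_lt, Nat.cast_le, finProdFinEquiv_apply_val] at hux hxv ⊢
  omega

theorem isOuterplanar_disjointTriangles (k : ℕ) : (disjointTriangles k).IsOuterplanar :=
  (isNoncrossing_disjointTriangles k).isOuterplanar <|
    Nat.cast_injective.comp (Fin.val_injective.comp finProdFinEquiv.injective)

theorem card_le_of_isIndepSet_disjointTriangles {k : ℕ} {I : Finset (Fin k × Fin 3)}
    (hI : (disjointTriangles k).IsIndepSet (I : Set (Fin k × Fin 3))) : I.card ≤ k := by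
  have hinj : Set.InjOn Prod.fst (I : Set (Fin k × Fin 3)) := fun x hx y hy hxy => by
    by_contra hne
    exact hI hx hy hne ⟨hxy, fun h => hne (Prod.ext hxy h)⟩
  simpa using Finset.card_le_card_of_injOn Prod.fst (fun _ _ => Finset.mem_univ _) hinj

theorem three_le_ncard_verts_of_isCycle {V : Type*} {G : SimpleGraph V} {v : V} {p : G.Walk v v}
    (hp : p.IsCycle) : 3 ≤ p.toSubgraph.verts.ncard := by
  classical
  have hsub : (p.support.tail.toFinset : Set V) ⊆ p.toSubgraph.verts := fun z hz =>
    (Walk.mem_verts_toSubgraph p).2 (List.mem_of_mem_tail (by simpa using hz))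
  calc 3 ≤ p.length := hp.three_le_length
    _ = (p.support.tail.toFinset : Set V).ncard := by
      rw [Set.ncard_coe_finset, List.toFinset_card_of_nodup hp.support_nodup]
      simp
    _ ≤ p.toSubgraph.verts.ncard := Set.ncard_le_ncard hsub <|
      p.support.finite_toSet.subset fun _ => (Walk.mem_verts_toSubgraph p).1

theorem three_mul_card_le_of_isDisjointCycleCollection {V : Type*} [Finite V] {G : SimpleGraph V}
    {C : Finset G.Subgraph} (hC : G.IsDisjointCycleCollection C) : 3 * C.card ≤ Nat.card V := by
  classical
  have := Fintype.ofFinite V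
  have hthree : ∀ H ∈ C, 3 ≤ H.verts.toFinset.card := fun H hH => by
    rw [← Set.ncard_eq_toFinset_card']
    obtain ⟨v, p, hp, rfl⟩ := hC.1 H hH
    exact three_le_ncard_verts_of_isCycle hp
  have hdisj : (C : Set G.Subgraph).PairwiseDisjoint fun H => H.verts.toFinset :=
    fun H hH H' hH' hne => Set.disjoint_toFinset.2 (hC.2 hH hH' hne)
  calc 3 * C.card = ∑ _H ∈ C, 3 := by simp [mul_comm]
    _ ≤ ∑ H ∈ C, H.verts.toFinset.card := Finset.sum_le_sum hthree
    _ = (C.biUnion fun H => H.verts.toFinset).card := (Finset.card_biUnion hdisj).symm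
    _ ≤ Nat.card V := Nat.card_eq_fintype_card (α := V) ▸ Finset.card_le_univ _

end DisjointTriangles

end Outerplanar

theorem mainTheorem3 :
    (∀ (V : Type*) [Fintype V] (G : SimpleGraph V), G.IsOuterplanar →
      ∃ (I : Finset V) (C : Finset G.Subgraph),
        G.IsIndepSet (I : Set V) ∧ G.IsDisjointCycleCollection C ∧
          9 * (I.card : ℤ) ≥ 4 * (Fintype.card V : ℤ) - 3 * (C.card : ℤ)) ∧
    (∀ k : ℕ, (SimpleGraph.disjointTriangles k).IsOuterplanar ∧
      ∀ (I : Finset (Fin k × Fin 3)) (C : Finset (SimpleGraph.disjointTriangles k).Subgraph),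
        (SimpleGraph.disjointTriangles k).IsIndepSet (I : Set (Fin k × Fin 3)) →
        (SimpleGraph.disjointTriangles k).IsDisjointCycleCollection C →
          9 * (I.card : ℤ) ≤ 4 * (Fintype.card (Fin k × Fin 3) : ℤ) - 3 * (C.card : ℤ)) := by
  refine ⟨fun V _ G hG => ?_, fun k =>
    ⟨Outerplanar.isOuterplanar_disjointTriangles k, fun I C hI hC => ?_⟩⟩
  · obtain ⟨I, C, hIC, hcard⟩ := Outerplanar.isPackable_of_isOuterplanarMinorFree
      (Outerplanar.isOuterplanarMinorFree_of_isOuterplanar hG)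
    obtain ⟨D, hD, hDC⟩ :=
      Outerplanar.exists_isDisjointCycleCollection hIC.isCore hIC.pairwiseDisjoint
    refine ⟨I, D, hIC.isIndepSet, hD, ?_⟩
    rw [Nat.card_eq_fintype_card] at hcard
    omega
  · have hIk : I.card ≤ k := Outerplanar.card_le_of_isIndepSet_disjointTriangles hI
    have hCk := Outerplanar.three_mul_card_le_of_isDisjointCycleCollection hC
    simp only [Nat.card_eq_fintype_card, Fintype.card_prod, Fintype.card_fin] at hCk ⊢
    omega
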